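/- Proposition (Compactness of the trace embedding). Let $n\in\mathbb N$, let $d\gamma(x)=(2\pi)^{-n/2}e^{-|x|^2/2}\,dx$ be the normalized Gaussian measure on $\mathbb R^n$, let $\Omega\subset\mathbb R^n$ be open (possibly unbounded) with $\gamma(\Omega)<1$, let $0<s<1$ and $a=1-2s\in(-1,1)$, and let $\mathcal C_\Omega=\Omega\times(0,\infty)$. Let $H^1_0(\Omega,\gamma)$ be the closure of $C_c^\infty(\Omega)$ in the norm $\big(\int_\Omega (u^2+|\nabla u|^2)\,d\gamma\big)^{1/2}$, and let $H^1_{0,L}(\mathcal C_\Omega,d\gamma(x)\otimes y^a\,dy)$ be the space of all $v\in H^1_{\mathrm{loc}}(\mathcal C_\Omega)$ with $$\iint_{\mathcal C_\Omega}y^a\big(v^2+|\nabla_{x,y}v|^2\big)\,d\gamma(x)\,dy<\infty$$ that vanish on the lateral boundary $\partial\Omega\times[0,\infty)$, in the sense that $v(\cdot,y)\in H^1_0(\Omega,\gamma)$ for almost every $y>0$, equipped with the norm $$\|v\|=\Big(\iint_{\mathcal C_\Omega}y^a|\nabla_{x,y}v|^2\,d\gamma(x)\,dy\Big)^{1/2}.$$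 Then every $v\in H^1_{0,L}(\mathcal C_\Omega,d\gamma(x)\otimes y^a\,dy)$ has a unique trace $\operatorname{tr}_\Omega v=v(\cdot,0)\in L^2(\Omega,\gamma)$, namely the limit of $v(\cdot,y)$ in $L^2(\Omega,\gamma)$ as $y\to0^+$ (outside a Lebesgue-null set of values of $y$, as $v$ is only defined almost everywhere), and the trace operator $$\operatorname{tr}_\Omega: H^1_{0,L}(\mathcal C_\Omega,d\gamma(x)\otimes y^a\,dy)\to L^2(\Omega,\gamma)$$ is linear, continuous and compact; that is, $\operatorname{tr}_\Omega\big(H^1_{0,L}(\mathcal C_\Omega,d\gamma(x)\otimes y^a\,dy)\big)\subset\subset L^2(\Omega,\gamma)$. -/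

import Mathlib

open MeasureTheory Filter Topology Set TopologicalSpace
open scoped ENNReal ContDiff

noncomputable section

namespace GaussTrace

/-- The Euclidean space `ℝⁿ`. -/
abbrev Eucl (n : ℕ) : Type := EuclideanSpace ℝ (Fin n)

/-- The density `φ(x) = (2π)^{-n/2} exp(-|x|²/2)`. -/
def gaussDensity (n : ℕ) (x : Eucl n) : ℝ :=
  (2 * Real.pi) ^ (-(n : ℝ) / 2) * Real.exp (-‖x‖ ^ 2 / 2)

/-- The normalized Gaussian measure `dγ = φ dx` on `ℝⁿ`. -/
def gauss (n : ℕ) : Measure (Eucl n) :=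
  volume.withDensity fun x => ENNReal.ofReal (gaussDensity n x)

/-- The Gaussian measure on an open set `Ω`. -/
abbrev gaussOn {n : ℕ} (Ω : Opens (Eucl n)) : Measure (Eucl n) :=
  (gauss n).restrict (Ω : Set (Eucl n))

/-- The space `L²(Ω, γ)`. -/
abbrev L2Gauss {n : ℕ} (Ω : Opens (Eucl n)) : Type := Lp ℝ 2 (gaussOn Ω)

/-- The measure `y^a dy` on `(0, ∞)`. -/
def powMeasure (a : ℝ) : Measure ℝ :=
  (volume.restrict (Ioi 0)).withDensity fun y => ENNReal.ofReal (y ^ a)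

instance (n : ℕ) : SFinite (gauss n) := by
  unfold gauss; infer_instance

instance (a : ℝ) : SFinite (powMeasure a) := by
  unfold powMeasure; infer_instance

/-- The infinite cylinder `𝒞_Ω = Ω × (0, ∞)`. -/
abbrev cylinder {n : ℕ} (Ω : Opens (Eucl n)) : Set (Eucl n × ℝ) :=
  (Ω : Set (Eucl n)) ×ˢ Ioi (0 : ℝ)

/-- The measure `dγ(x) ⊗ y^a dy` on the cylinder `𝒞_Ω`. -/
abbrev cylMeasure {n : ℕ} (Ω : Opens (Eucl n)) (a : ℝ) : Measure (Eucl n × ℝ) :=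
  (gaussOn Ω).prod (powMeasure a)

/-- `φ ∈ C_c^∞(U)`. -/
def IsTestFunction {F : Type*} [NormedAddCommGroup F] [NormedSpace ℝ F] (U : Set F)
    (φ : F → ℝ) : Prop :=
  ContDiff ℝ ∞ φ ∧ HasCompactSupport φ ∧ tsupport φ ⊆ U

/-- `u ∈ H¹₀(Ω, γ)`: the closure of `C_c^∞(Ω)` in the norm
`(∫_Ω u² dγ + ∫_Ω |∇u|² dγ)^{1/2}`, that is, `u` is the `L²(Ω, γ)`-limit of test functions whose
gradients converge in `L²(Ω, γ)`. -/
def MemH10 {n : ℕ} (Ω : Opens (Eucl n)) (u : Eucl n → ℝ) : Prop :=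
  MemLp u 2 (gaussOn Ω) ∧
  ∃ g : Eucl n → Eucl n, MemLp g 2 (gaussOn Ω) ∧
  ∃ φ : ℕ → Eucl n → ℝ, (∀ k, IsTestFunction (Ω : Set (Eucl n)) (φ k)) ∧
    Tendsto (fun k => eLpNorm (fun x => φ k x - u x) 2 (gaussOn Ω)) atTop (𝓝 0) ∧
    Tendsto (fun k => eLpNorm (fun x => gradient (φ k) x - g x) 2 (gaussOn Ω)) atTop (𝓝 0)

/-- The Euclidean space `ℝⁿ × ℝ = ℝⁿ⁺¹` in which the gradient `∇_{x,y} v` takes its values,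
with `|∇_{x,y} v|² = |∇_x v|² + |∂_y v|²`. -/
abbrev EuclProd (n : ℕ) : Type := WithLp 2 (Eucl n × ℝ)

/-- `g = ∇_{x,y} v` in the cylinder in the weak (distributional) sense:
`∫ v ∂_h φ dx dy = - ∫ (g · h) φ dx dy` for all `φ ∈ C_c^∞(𝒞_Ω)` and all directions `h`.
It is only used for functions that are square integrable with respect to `dγ ⊗ y^a dy`,
and these are in `L²_loc(𝒞_Ω)`. -/
def HasWeakGradient {n : ℕ} (Ω : Opens (Eucl n)) (v : Eucl n × ℝ → ℝ)
    (g : Eucl n × ℝ → EuclProd n) : Prop :=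
  ∀ φ : Eucl n × ℝ → ℝ, IsTestFunction (cylinder Ω) φ → ∀ h : EuclProd n,
    ∫ z in cylinder Ω, v z * fderiv ℝ φ z (WithLp.ofLp h) =
      -∫ z in cylinder Ω, inner ℝ (g z) h * φ z

/-! ### Local integrability, and uniqueness of the weak gradient -/

section aux

variable {n : ℕ} (Ω : Opens (Eucl n)) (a : ℝ)

theorem isOpen_cylinder : IsOpen (cylinder Ω) := Ω.isOpen.prod isOpen_Ioi

theorem continuous_gaussDensity : Continuous (gaussDensity n) := by
  unfold gaussDensity; fun_prop

theorem gaussDensity_pos (x : Eucl n) : 0 < gaussDensity n x := by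
  unfold gaussDensity; positivity

theorem cylMeasure_eq : cylMeasure Ω a = (volume.restrict (cylinder Ω)).withDensity
    (fun z => ENNReal.ofReal (gaussDensity n z.1) * ENNReal.ofReal (z.2 ^ a)) := by
  have h1 : Measurable fun x => ENNReal.ofReal (gaussDensity n x) :=
    continuous_gaussDensity.measurable.ennreal_ofReal
  have h2 : Measurable fun y : ℝ => ENNReal.ofReal (y ^ a) := by fun_prop
  rw [cylMeasure, gaussOn, gauss, powMeasure, restrict_withDensity Ω.isOpen.measurableSet,
    prod_withDensity h1 h2, Measure.prod_restrict, ← Measure.volume_eq_prod]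

theorem ae_cylMeasure_iff {p : Eucl n × ℝ → Prop} :
    (∀ᵐ z ∂cylMeasure Ω a, p z) ↔ ∀ᵐ z ∂(volume.restrict (cylinder Ω)), p z := by
  have h1 : Measurable fun x => ENNReal.ofReal (gaussDensity n x) :=
    continuous_gaussDensity.measurable.ennreal_ofReal
  have h2 : Measurable fun y : ℝ => ENNReal.ofReal (y ^ a) := by fun_prop
  have h3 : Measurable fun z : Eucl n × ℝ =>
      ENNReal.ofReal (gaussDensity n z.1) * ENNReal.ofReal (z.2 ^ a) :=
    (h1.comp measurable_fst).mul (h2.comp measurable_snd)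
  rw [cylMeasure_eq, ae_withDensity_iff h3]
  have hm : MeasurableSet (cylinder Ω) := (isOpen_cylinder Ω).measurableSet
  rw [ae_restrict_iff' hm, ae_restrict_iff' hm]
  refine eventually_congr (Eventually.of_forall fun z => ?_)
  refine forall_congr' fun hz => ?_
  have : ENNReal.ofReal (gaussDensity n z.1) * ENNReal.ofReal (z.2 ^ a) ≠ 0 := by
    have := gaussDensity_pos z.1
    have h3 : 0 < z.2 ^ a := Real.rpow_pos_of_pos hz.2 a
    exact mul_ne_zero (by simpa using this) (by simpa using h3)
  simp [this]

theorem integrableOn_compact {G : Type*} [NormedAddCommGroup G] {f : Eucl n × ℝ → G}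
    (hf : MemLp f 2 (cylMeasure Ω a)) {K : Set (Eucl n × ℝ)} (hK : IsCompact K)
    (hKU : K ⊆ cylinder Ω) : IntegrableOn f K := by
  set w : Eucl n × ℝ → ℝ := fun z => gaussDensity n z.1 * z.2 ^ a with hw
  have hpos : ∀ z ∈ K, 0 < w z := fun z hz =>
    mul_pos (gaussDensity_pos _) (Real.rpow_pos_of_pos (hKU hz).2 a)
  have hcont : ContinuousOn w K := by
    refine (continuous_gaussDensity.comp continuous_fst).continuousOn.mul ?_
    exact continuous_snd.continuousOn.rpow_const fun z hz => Or.inl (hKU hz).2.ne'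
  obtain ⟨c, hc, hcw⟩ : ∃ c : ℝ, 0 < c ∧ ∀ z ∈ K, c ≤ w z := by
    rcases K.eq_empty_or_nonempty with rfl | hne
    · exact ⟨1, one_pos, by simp⟩
    · obtain ⟨z, hz, hmin⟩ := hK.exists_isMinOn hne hcont
      exact ⟨w z, hpos z hz, fun y hy => hmin hy⟩
  have hle : (volume.restrict K : Measure (Eucl n × ℝ)) ≤
      (ENNReal.ofReal c)⁻¹ • cylMeasure Ω a := by
    refine Measure.le_iff.2 fun s hs => ?_
    have hsK : MeasurableSet (s ∩ K) := hs.inter hK.measurableSet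
    rw [Measure.restrict_apply hs, Measure.smul_apply, smul_eq_mul]
    have h1 : ENNReal.ofReal c * volume (s ∩ K) ≤ cylMeasure Ω a (s ∩ K) := by
      rw [cylMeasure_eq, withDensity_apply _ hsK, Measure.restrict_restrict hsK,
        inter_eq_left.2 (inter_subset_right.trans hKU), ← setLIntegral_const]
      refine setLIntegral_mono' hsK fun z hz => ?_
      rw [← ENNReal.ofReal_mul (gaussDensity_pos _).le]
      exact ENNReal.ofReal_le_ofReal (hcw z hz.2)
    have hc0 : ENNReal.ofReal c ≠ 0 := by simpa using hc
    calc volume (s ∩ K)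
        = (ENNReal.ofReal c)⁻¹ * (ENNReal.ofReal c * volume (s ∩ K)) := by
          rw [← mul_assoc, ENNReal.inv_mul_cancel hc0 ENNReal.ofReal_ne_top, one_mul]
      _ ≤ (ENNReal.ofReal c)⁻¹ * cylMeasure Ω a s := by
          gcongr
          exact h1.trans (measure_mono inter_subset_left)
  have hmem : MemLp f 2 (volume.restrict K) :=
    hf.of_measure_le_smul (by simpa using hc) hle
  have : IsFiniteMeasure (volume.restrict K : Measure (Eucl n × ℝ)) :=
    ⟨by simpa using hK.measure_lt_top⟩
  exact hmem.integrable (by norm_num)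

theorem integrable_test_smul {G : Type*} [NormedAddCommGroup G] [NormedSpace ℝ G]
    {f : Eucl n × ℝ → G}
    (hf : MemLp f 2 (cylMeasure Ω a)) {ψ : Eucl n × ℝ → ℝ} (hψ : Continuous ψ)
    (hc : HasCompactSupport ψ) (hs : tsupport ψ ⊆ cylinder Ω) :
    Integrable (fun z => ψ z • f z) := by
  have h1 : IntegrableOn (fun z => ψ z • f z) (tsupport ψ) :=
    (integrableOn_compact Ω a hf hc hs).continuousOn_smul hψ.continuousOn hc
  refine (integrableOn_iff_integrable_of_support_subset ?_).1 h1
  intro z hz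
  refine subset_tsupport ψ fun h => hz ?_
  simp [h]

variable {Ω a}

theorem IsTestFunction.fderiv_apply {φ : Eucl n × ℝ → ℝ} (h : IsTestFunction (cylinder Ω) φ)
    (e : Eucl n × ℝ) : Continuous (fun z => fderiv ℝ φ z e) ∧
      HasCompactSupport (fun z => fderiv ℝ φ z e) ∧
      tsupport (fun z => fderiv ℝ φ z e) ⊆ cylinder Ω := by
  refine ⟨(h.1.continuous_fderiv (by simp)).clm_apply continuous_const,
    h.2.1.fderiv_apply ℝ e, (tsupport_fderiv_apply_subset ℝ e).trans h.2.2⟩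

theorem integrable_left {v : Eucl n × ℝ → ℝ} (hv : MemLp v 2 (cylMeasure Ω a))
    {φ : Eucl n × ℝ → ℝ} (h : IsTestFunction (cylinder Ω) φ) (e : Eucl n × ℝ) :
    Integrable (fun z => v z * fderiv ℝ φ z e) := by
  obtain ⟨h1, h2, h3⟩ := h.fderiv_apply e
  simpa [mul_comm] using integrable_test_smul Ω a hv h1 h2 h3

theorem integrable_right {g : Eucl n × ℝ → EuclProd n} (hg : MemLp g 2 (cylMeasure Ω a))
    {φ : Eucl n × ℝ → ℝ} (h : IsTestFunction (cylinder Ω) φ) (e : EuclProd n) :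
    Integrable (fun z => inner ℝ (g z) e * φ z) := by
  have h0 : MemLp (fun z => inner ℝ (g z) e) 2 (cylMeasure Ω a) := by
    simpa only [real_inner_comm] using hg.const_inner (𝕜 := ℝ) e
  simpa [mul_comm] using integrable_test_smul Ω a h0 h.1.continuous h.2.1 h.2.2

theorem HasWeakGradient.congr {v v' : Eucl n × ℝ → ℝ} {g g' : Eucl n × ℝ → EuclProd n}
    (h : HasWeakGradient Ω v g) (hv : v =ᵐ[cylMeasure Ω a] v')
    (hg : g =ᵐ[cylMeasure Ω a] g') : HasWeakGradient Ω v' g' := by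
  intro φ hφ e
  have hv' := (ae_cylMeasure_iff Ω a).1 hv
  have hg' := (ae_cylMeasure_iff Ω a).1 hg
  have e1 := integral_congr_ae (μ := volume.restrict (cylinder Ω))
    (f := fun z => v z * fderiv ℝ φ z (WithLp.ofLp e))
    (g := fun z => v' z * fderiv ℝ φ z (WithLp.ofLp e))
    (by filter_upwards [hv'] with z hz; simp [hz])
  have e2 := integral_congr_ae (μ := volume.restrict (cylinder Ω))
    (f := fun z => inner ℝ (g z) e * φ z)
    (g := fun z => inner ℝ (g' z) e * φ z)
    (by filter_upwards [hg'] with z hz; simp [hz])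
  rw [← e1, ← e2]
  exact h φ hφ e

theorem HasWeakGradient.add {v w : Eucl n × ℝ → ℝ} {g k : Eucl n × ℝ → EuclProd n}
    (hv : MemLp v 2 (cylMeasure Ω a)) (hw : MemLp w 2 (cylMeasure Ω a))
    (hg : MemLp g 2 (cylMeasure Ω a)) (hk : MemLp k 2 (cylMeasure Ω a))
    (h₁ : HasWeakGradient Ω v g) (h₂ : HasWeakGradient Ω w k) :
    HasWeakGradient Ω (v + w) (g + k) := by
  intro φ hφ e
  simp only [Pi.add_apply, add_mul, inner_add_left]
  rw [integral_add (integrable_left hv hφ _).integrableOn (integrable_left hw hφ _).integrableOn,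
    integral_add (integrable_right hg hφ e).integrableOn (integrable_right hk hφ e).integrableOn,
    h₁ φ hφ e, h₂ φ hφ e]
  ring

theorem HasWeakGradient.smul {v : Eucl n × ℝ → ℝ} {g : Eucl n × ℝ → EuclProd n}
    (c : ℝ) (h : HasWeakGradient Ω v g) : HasWeakGradient Ω (c • v) (c • g) := by
  intro φ hφ e
  simp only [Pi.smul_apply, smul_eq_mul, inner_smul_left, mul_assoc]
  rw [integral_const_mul, integral_const_mul, h φ hφ e]
  simp

theorem HasWeakGradient.unique {v : Eucl n × ℝ → ℝ} {g k : Eucl n × ℝ → EuclProd n}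
    (hg : MemLp g 2 (cylMeasure Ω a)) (hk : MemLp k 2 (cylMeasure Ω a))
    (h₁ : HasWeakGradient Ω v g) (h₂ : HasWeakGradient Ω v k) : g =ᵐ[cylMeasure Ω a] k := by
  have hU := isOpen_cylinder Ω
  have hgk : MemLp (g - k) 2 (cylMeasure Ω a) := hg.sub hk
  have hloc : LocallyIntegrableOn (g - k) (cylinder Ω) :=
    (locallyIntegrableOn_iff hU.isLocallyClosed).2 fun K hKU hK =>
      integrableOn_compact Ω a hgk hK hKU
  have key := hU.ae_eq_zero_of_integral_contDiff_smul_eq_zero hloc fun φ h1 h2 h3 => by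
    have hφ : IsTestFunction (cylinder Ω) φ := ⟨h1, h2, h3⟩
    refine ext_inner_right ℝ fun e => ?_
    have hi := integrable_test_smul Ω a hgk h1.continuous h2 h3
    have hsup : ∀ q : Eucl n × ℝ → EuclProd n, ∫ z in cylinder Ω, inner ℝ (q z) e * φ z =
        ∫ z, inner ℝ (q z) e * φ z := fun q => by
      refine setIntegral_eq_integral_of_forall_compl_eq_zero fun z hz => ?_
      rw [image_eq_zero_of_notMem_tsupport fun h => hz (h3 h), mul_zero]
    have hsub : ∫ z, inner ℝ ((g - k) z) e * φ z = 0 := by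
      simp only [Pi.sub_apply, inner_sub_left, sub_mul]
      rw [integral_sub (integrable_right hg hφ e) (integrable_right hk hφ e), ← hsup g, ← hsup k]
      have h4 := h₁ φ hφ e
      have h5 := h₂ φ hφ e
      linarith
    rw [inner_zero_left, real_inner_comm, ← integral_inner hi, ← hsub]
    refine integral_congr_ae (Eventually.of_forall fun z => ?_)
    simp only [inner_smul_right, real_inner_comm]
    ring
  refine (ae_cylMeasure_iff Ω a).2 ?_
  rw [ae_restrict_iff' hU.measurableSet]
  filter_upwards [key] with z hz hzU
  exact sub_eq_zero.1 (hz hzU)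

theorem IsTestFunction.add {F : Type*} [NormedAddCommGroup F] [NormedSpace ℝ F] {U : Set F}
    {φ ψ : F → ℝ} (hφ : IsTestFunction U φ) (hψ : IsTestFunction U ψ) :
    IsTestFunction U (φ + ψ) :=
  ⟨hφ.1.add hψ.1, hφ.2.1.add hψ.2.1,
    (tsupport_add φ ψ).trans (union_subset hφ.2.2 hψ.2.2)⟩

theorem IsTestFunction.smul {F : Type*} [NormedAddCommGroup F] [NormedSpace ℝ F] {U : Set F}
    {φ : F → ℝ} (c : ℝ) (hφ : IsTestFunction U φ) : IsTestFunction U (c • φ) :=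
  ⟨hφ.1.const_smul c, hφ.2.1.smul_left (f := fun _ => c),
    (tsupport_smul_subset_right (fun _ => c) φ).trans hφ.2.2⟩

theorem IsTestFunction.differentiable {F : Type*} [NormedAddCommGroup F] [NormedSpace ℝ F]
    {U : Set F} {φ : F → ℝ} (hφ : IsTestFunction U φ) : Differentiable ℝ φ :=
  hφ.1.differentiable (by simp)

theorem gradient_eq (φ : Eucl n → ℝ) (x : Eucl n) :
    gradient φ x = (InnerProductSpace.toDual ℝ (Eucl n)).symm (fderiv ℝ φ x) := rfl

theorem IsTestFunction.memLp_two {φ : Eucl n → ℝ} (hφ : IsTestFunction (Ω : Set (Eucl n)) φ) :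
    Continuous φ ∧ Continuous (gradient φ) :=
  ⟨hφ.1.continuous, (InnerProductSpace.toDual ℝ (Eucl n)).symm.continuous.comp
    (hφ.1.continuous_fderiv (by simp))⟩

theorem MemH10.congr {u u' : Eucl n → ℝ} (h : MemH10 Ω u) (he : u =ᵐ[gaussOn Ω] u') :
    MemH10 Ω u' := by
  obtain ⟨hu, g, hg, φ, h1, h2, h3⟩ := h
  refine ⟨hu.ae_eq he, g, hg, φ, h1, ?_, h3⟩
  refine h2.congr fun k => eLpNorm_congr_ae ?_
  filter_upwards [he] with x hx
  rw [hx]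

theorem MemH10.add {u w : Eucl n → ℝ} (h : MemH10 Ω u) (h' : MemH10 Ω w) :
    MemH10 Ω (u + w) := by
  obtain ⟨hu, g, hg, φ, h1, h2, h3⟩ := h
  obtain ⟨hw, k, hk, ψ, h1', h2', h3'⟩ := h'
  refine ⟨hu.add hw, g + k, hg.add hk, fun j => φ j + ψ j, fun j => (h1 j).add (h1' j), ?_, ?_⟩
  · refine tendsto_of_tendsto_of_tendsto_of_le_of_le tendsto_const_nhds
      (by simpa using h2.add h2') (fun _ => zero_le) fun j => ?_
    have := eLpNorm_add_le (μ := gaussOn Ω) (p := 2)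
      (f := fun x => φ j x - u x) (g := fun x => ψ j x - w x)
      ((h1 j).memLp_two.1.aestronglyMeasurable.sub hu.1)
      ((h1' j).memLp_two.1.aestronglyMeasurable.sub hw.1) (by norm_num)
    refine le_trans (le_of_eq ?_) this
    congr 1; ext x; simp; ring
  · refine tendsto_of_tendsto_of_tendsto_of_le_of_le tendsto_const_nhds
      (by simpa using h3.add h3') (fun _ => zero_le) fun j => ?_
    have := eLpNorm_add_le (μ := gaussOn Ω) (p := 2)
      (f := fun x => gradient (φ j) x - g x) (g := fun x => gradient (ψ j) x - k x)
      ((h1 j).memLp_two.2.aestronglyMeasurable.sub hg.1)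
      ((h1' j).memLp_two.2.aestronglyMeasurable.sub hk.1) (by norm_num)
    refine le_trans (le_of_eq ?_) this
    congr 1; ext1 x
    simp only [gradient_eq, Pi.add_apply]
    rw [fderiv_add ((h1 j).differentiable x) ((h1' j).differentiable x), map_add]
    abel

theorem MemH10.smul {u : Eucl n → ℝ} (c : ℝ) (h : MemH10 Ω u) : MemH10 Ω (c • u) := by
  obtain ⟨hu, g, hg, φ, h1, h2, h3⟩ := h
  have hc : (‖c‖ₑ : ℝ≥0∞) ≠ ⊤ := by simp
  refine ⟨hu.const_smul c, c • g, hg.const_smul c, fun j => c • φ j,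
    fun j => (h1 j).smul c, ?_, ?_⟩
  · have := ENNReal.Tendsto.const_mul h2 (Or.inr hc)
    rw [mul_zero] at this
    refine this.congr fun j => ?_
    rw [← eLpNorm_const_smul]
    congr 1; ext x; simp; ring
  · have := ENNReal.Tendsto.const_mul h3 (Or.inr hc)
    rw [mul_zero] at this
    refine this.congr fun j => ?_
    rw [← eLpNorm_const_smul]
    congr 1; ext1 x
    simp only [gradient_eq, Pi.smul_apply]
    rw [fderiv_const_smul ((h1 j).differentiable x), map_smul, smul_sub]

theorem MemH10.zero : MemH10 Ω 0 := by
  refine ⟨MemLp.zero, 0, MemLp.zero, fun _ => 0, fun _ => ⟨contDiff_const, ?_, ?_⟩, ?_, ?_⟩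
  · exact HasCompactSupport.zero
  · simp [tsupport]
  · simp
  · simp [gradient_eq]

theorem ae_slice {p : Eucl n × ℝ → Prop} (h : ∀ᵐ z ∂cylMeasure Ω a, p z) :
    ∀ᵐ y ∂powMeasure a, ∀ᵐ x ∂gaussOn Ω, p (x, y) :=
  Measure.ae_ae_of_ae_prod
    ((Measure.measurePreserving_swap (μ := powMeasure a)
      (ν := gaussOn Ω)).quasiMeasurePreserving.ae h)

end aux

/-! ### The energy space and the trace -/

/-- The space `H¹_{0,L}(𝒞_Ω, dγ(x) ⊗ y^a dy)` as a linear subspace of `L²(𝒞_Ω, dγ ⊗ y^a dy)`: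
the functions `v` with a weak gradient in `L²(𝒞_Ω, dγ ⊗ y^a dy)` that vanish on the lateral
boundary `∂Ω × [0, ∞)` in the sense that `v(·, y) ∈ H¹₀(Ω, γ)` for almost every `y > 0`. -/
def energySubmodule {n : ℕ} (Ω : Opens (Eucl n)) (a : ℝ) :
    Submodule ℝ (Lp ℝ 2 (cylMeasure Ω a)) where
  carrier := {v | (∃ g : Lp (EuclProd n) 2 (cylMeasure Ω a), HasWeakGradient Ω v g) ∧
    ∀ᵐ y ∂powMeasure a, MemH10 Ω fun x => v (x, y)}
  zero_mem' := by
    refine ⟨⟨0, ?_⟩, ?_⟩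
    · have h0 : HasWeakGradient Ω 0 0 := by intro φ _ e; simp
      exact h0.congr (Lp.coeFn_zero ..).symm (Lp.coeFn_zero ..).symm
    · filter_upwards [ae_slice (Lp.coeFn_zero ℝ 2 (cylMeasure Ω a))] with y hy
      exact MemH10.zero.congr (hy.mono fun x hx => hx.symm)
  add_mem' := by
    rintro v w ⟨⟨g, hg⟩, hv⟩ ⟨⟨k, hk⟩, hw⟩
    refine ⟨⟨g + k, ?_⟩, ?_⟩
    · exact (HasWeakGradient.add (Lp.memLp v) (Lp.memLp w) (Lp.memLp g) (Lp.memLp k) hg hk).congr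
        (Lp.coeFn_add v w).symm (Lp.coeFn_add g k).symm
    · filter_upwards [hv, hw, ae_slice (Lp.coeFn_add v w)] with y h1 h2 hy
      exact (h1.add h2).congr (hy.mono fun x hx => hx.symm)
  smul_mem' := by
    rintro c v ⟨⟨g, hg⟩, hv⟩
    refine ⟨⟨c • g, ?_⟩, ?_⟩
    · exact (hg.smul c).congr (Lp.coeFn_smul c v).symm (Lp.coeFn_smul c g).symm
    · filter_upwards [hv, ae_slice (Lp.coeFn_smul c v)] with y h1 hy
      exact (h1.smul c).congr (hy.mono fun x hx => hx.symm)

/-- The space `H¹_{0,L}(𝒞_Ω, dγ(x) ⊗ y^a dy)`. It is a copy of `energySubmodule Ω a`, which does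
not carry the norm of `L²` but the energy norm defined below. -/
def EnergySpace {n : ℕ} (Ω : Opens (Eucl n)) (a : ℝ) : Type := energySubmodule Ω a

namespace EnergySpace

variable {n : ℕ} {Ω : Opens (Eucl n)} {a : ℝ}

instance : AddCommGroup (EnergySpace Ω a) := inferInstanceAs (AddCommGroup (energySubmodule Ω a))

instance : Module ℝ (EnergySpace Ω a) := inferInstanceAs (Module ℝ (energySubmodule Ω a))

/-- The function on the cylinder (an element of `L²(𝒞_Ω, dγ ⊗ y^a dy)`) underlying an element of
the energy space. -/
def toL2 : EnergySpace Ω a →ₗ[ℝ] Lp ℝ 2 (cylMeasure Ω a) := (energySubmodule Ω a).subtype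

theorem exists_weakGradient (v : EnergySpace Ω a) :
    ∃ g : Lp (EuclProd n) 2 (cylMeasure Ω a), HasWeakGradient Ω (toL2 v) g := v.2.1

theorem weakGradient_unique {v : Eucl n × ℝ → ℝ} {g k : Lp (EuclProd n) 2 (cylMeasure Ω a)}
    (hg : HasWeakGradient Ω v g) (hk : HasWeakGradient Ω v k) : g = k :=
  Lp.ext (hg.unique (Lp.memLp g) (Lp.memLp k) hk)

/-- The weak gradient `∇_{x,y} v ∈ L²(𝒞_Ω, dγ ⊗ y^a dy)` of an element of the energy space. -/
def grad : EnergySpace Ω a →ₗ[ℝ] Lp (EuclProd n) 2 (cylMeasure Ω a) where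
  toFun v := (exists_weakGradient v).choose
  map_add' v w := by
    refine weakGradient_unique (exists_weakGradient (v + w)).choose_spec ?_
    have h := HasWeakGradient.add (Lp.memLp (toL2 v)) (Lp.memLp (toL2 w)) (Lp.memLp _)
      (Lp.memLp _) (exists_weakGradient v).choose_spec (exists_weakGradient w).choose_spec
    exact h.congr (by rw [map_add]; exact (Lp.coeFn_add _ _).symm) (Lp.coeFn_add _ _).symm
  map_smul' c v := by
    refine weakGradient_unique (exists_weakGradient (c • v)).choose_spec ?_
    have h := (exists_weakGradient v).choose_spec.smul c
    exact h.congr (by rw [map_smul]; exact (Lp.coeFn_smul _ _).symm) (Lp.coeFn_smul _ _).symm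

theorem hasWeakGradient (v : EnergySpace Ω a) : HasWeakGradient Ω (toL2 v) (grad v) :=
  (exists_weakGradient v).choose_spec

/-- The energy norm `‖v‖ = (∬ y^a |∇_{x,y} v|² dγ(x) dy)^{1/2}`. (That it is definite when
`γ(Ω) < 1`, and then equivalent to the full `H¹` norm, is the Gaussian Poincaré inequality,
which is neither used nor assumed here.) -/
instance : SeminormedAddCommGroup (EnergySpace Ω a) := SeminormedAddCommGroup.induced _ _ grad

instance : NormedSpace ℝ (EnergySpace Ω a) := NormedSpace.induced ℝ _ _ grad

theorem norm_eq (v : EnergySpace Ω a) : ‖v‖ = ‖grad v‖ := rfl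

end EnergySpace

/-- `u ∈ L²(Ω, γ)` is the trace on `Ω` (at `y = 0`) of the function `v` on the cylinder:
`v(·, y) → u` in `L²(Ω, γ)` as `y → 0⁺`. As `v` is only defined up to null sets,
so is the slice `v(·, y)`, and the limit disregards a null set of values of `y`. -/
def IsTrace {n : ℕ} {Ω : Opens (Eucl n)} (v : Eucl n × ℝ → ℝ) (u : L2Gauss Ω) : Prop :=
  Tendsto (fun y : ℝ => eLpNorm (fun x => v (x, y) - u x) 2 (gaussOn Ω))
    (𝓝[>] (0 : ℝ) ⊓ ae volume) (𝓝 0)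

end GaussTrace

end

noncomputable section

namespace GaussTrace

open ProbabilityTheory

/-! Write `a = 1 - 2s < 1`. Two facts combine: slices of `v` near the bottom are close to the trace,
and each well-chosen slice is controlled in `H¹₀(Ω, γ)`.

Vertical direction. Since `t^(-a)` is integrable at `0`, Cauchy–Schwarz gives `(∫₀^y |∂_y v| dt)² ≤
y^(1-a)/(1-a) · ∫ t^a |∂_y v|² dt`. Testing the weak gradient with products `φ(x)ψ(y)` shows that
`v(·,y) - ∫₀^y ∂_y v dt` does not depend on `y`, up to null sets. This common value is the trace,
and `v(·,y)` approaches it at the rate `√(y^(1-a)/(1-a)) ‖v‖`, uniformly on bounded sets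
(`HasWeakGradient.exists_trace`).

Horizontal direction. An averaging argument on `(ε, 2ε)` finds a height `y` at which the slice `u =
v(·,y)` has horizontal gradient at most `A(ε) ‖v‖` in `L²(Ω, γ)` (`EnergySpace.exists_slice`).
Everything needed about `H¹₀(Ω, γ)` comes from one estimate (`lintegral_sub_rotation_le`): moving
`f(x)` to `f(cos θ x + sin θ z)`, with `z` an independent Gaussian variable, costs at most `θ ‖∇f‖`
in `L²`. At `θ = π/2` this is a Poincaré inequality, which controls `‖u‖` because functions
supported in `Ω` with `γ(Ω) < 1` cannot be close to constants. For small `θ` it says that the Mehler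
average `T_θ` is within `θ ‖∇u‖` of the identity. For `0 < θ < π/2` the operator `T_θ` has a square
integrable kernel and is therefore compact (`exists_compact_mehler`).

Hence, on the unit ball, the trace is uniformly close to slices `u`, these are uniformly close to
`T_θ u`, and the `T_θ u` lie in a totally bounded set. So the image of the unit ball is totally
bounded. -/

theorem lintegral_mul_sq_le {α : Type*} [MeasurableSpace α] {μ : Measure α} {f g : α → ℝ≥0∞}
    (hf : AEMeasurable f μ) (hg : AEMeasurable g μ) :
    (∫⁻ x, f x * g x ∂μ) ^ 2 ≤ (∫⁻ x, f x ^ 2 ∂μ) * ∫⁻ x, g x ^ 2 ∂μ := by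
  have h := ENNReal.lintegral_mul_le_Lp_mul_Lq μ Real.HolderConjugate.two_two hf hg
  have h2 := ENNReal.rpow_le_rpow h (z := 2) (by norm_num)
  rw [ENNReal.mul_rpow_of_nonneg _ _ (by norm_num), ← ENNReal.rpow_mul, ← ENNReal.rpow_mul] at h2
  simpa using h2

theorem eLpNorm_two_sq {α E : Type*} [MeasurableSpace α] {μ : Measure α} [NormedAddCommGroup E]
    (f : α → E) : eLpNorm f 2 μ ^ 2 = ∫⁻ x, ‖f x‖ₑ ^ 2 ∂μ := by
  have := eLpNorm_nnreal_pow_eq_lintegral (f := f) (μ := μ) (p := 2) (by norm_num)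
  simpa using this

/-! ### Rotation invariance of the Gaussian measure and the Poincaré inequality -/

/-- The characteristic functions agree. This makes the rotation invariance and the identity
covariance of the standard Gaussian available for the measure given by its density. -/
theorem gauss_eq_stdGaussian (n : ℕ) : gauss n = stdGaussian (Eucl n) := by
  have hint : Integrable (gaussDensity n) := by
    unfold gaussDensity
    refine Integrable.const_mul ?_ _
    have := (GaussianFourier.integrable_cexp_neg_mul_sq_norm_add (V := Eucl n)
      (b := (1 / 2 : ℝ)) (by norm_num) 0 0).norm
    refine this.congr (Eventually.of_forall fun x => ?_)
    simp only [Complex.norm_exp]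
    congr 1
    simp [← Complex.ofReal_pow]
    ring
  have : IsFiniteMeasure (gauss n) := isFiniteMeasure_withDensity_ofReal hint.2
  refine Measure.ext_of_charFun (E := Eucl n) ?_
  ext t
  rw [charFun_stdGaussian, charFun_apply, gauss, integral_withDensity_eq_integral_toReal_smul
    (continuous_gaussDensity.measurable.ennreal_ofReal) (by simp)]
  have h := GaussianFourier.integral_cexp_neg_mul_sq_norm_add (V := Eucl n)
    (b := (1 / 2 : ℝ)) (by norm_num) Complex.I t
  calc _ = ∫ x : Eucl n, (((2 * Real.pi) ^ (-(n : ℝ) / 2) : ℝ) : ℂ) *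
        Complex.exp (-((1 / 2 : ℝ) : ℂ) * ‖x‖ ^ 2 + Complex.I * (inner ℝ t x : ℝ)) := by
        refine integral_congr_ae (Eventually.of_forall fun x => ?_)
        simp only [ENNReal.toReal_ofReal (gaussDensity_pos x).le]
        simp only [gaussDensity, Complex.real_smul, Complex.ofReal_mul, Complex.ofReal_exp]
        rw [mul_assoc, ← Complex.exp_add]
        congr 2
        rw [real_inner_comm]
        push_cast
        ring
    _ = _ := by
        rw [integral_const_mul, h]
        have h2 : ((Real.pi : ℂ) / ((1 / 2 : ℝ) : ℂ)) ^ ((Module.finrank ℝ (Eucl n) : ℂ) / 2) =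
            (((2 * Real.pi) ^ ((n : ℝ) / 2) : ℝ) : ℂ) := by
          rw [Complex.ofReal_cpow (by positivity)]
          simp
          congr 1
          ring
        rw [h2, ← mul_assoc, ← Complex.ofReal_mul, ← Real.rpow_add (by positivity)]
        have h3 : -(n : ℝ) / 2 + n / 2 = 0 := by ring
        rw [h3, Real.rpow_zero, Complex.ofReal_one, one_mul]
        congr 1
        push_cast
        rw [Complex.I_sq]
        ring

instance (n : ℕ) : IsProbabilityMeasure (gauss n) := by
  rw [gauss_eq_stdGaussian]; infer_instance

theorem measurePreserving_rotation (n : ℕ) (θ : ℝ) :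
    MeasurePreserving (fun p : Eucl n × Eucl n =>
      (Real.cos θ • p.1 + Real.sin θ • p.2, -Real.sin θ • p.1 + Real.cos θ • p.2))
      ((gauss n).prod (gauss n)) ((gauss n).prod (gauss n)) := by
  refine ⟨by fun_prop, ?_⟩
  rw [gauss_eq_stdGaussian]
  exact IsGaussian.map_rotation_eq_self_of_forall_strongDual_eq_zero
    integral_strongDual_stdGaussian θ

theorem lintegral_inner_sq (n : ℕ) (a : Eucl n) :
    ∫⁻ z, ‖inner ℝ a z‖ₑ ^ 2 ∂gauss n = ‖a‖ₑ ^ 2 := by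
  rw [gauss_eq_stdGaussian]
  have h := variance_dual_stdGaussian (innerSL ℝ a)
  have h0 := integral_strongDual_stdGaussian (innerSL ℝ a)
  have hm : MemLp (innerSL ℝ a) 2 (stdGaussian (Eucl n)) :=
    IsGaussian.memLp_dual _ _ _ (by simp)
  have h3 : evariance (innerSL ℝ a) (stdGaussian (Eucl n)) = ENNReal.ofReal (‖a‖ ^ 2) := by
    rw [← hm.ofReal_variance_eq, h]; simp
  rw [evariance, h0] at h3
  simp only [sub_zero, innerSL_apply_apply] at h3
  rw [h3, ENNReal.ofReal_pow (norm_nonneg _), ofReal_norm]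

/-- Follow the path `x_t = cos t x + sin t z` from `x` to its position at angle `θ`. Its velocity is
the second component of the rotated pair, so at each `t` position and velocity are again independent
standard Gaussians, and the mean square of `⟪∇f(x_t), x_t'⟫` is `∫ |∇f|² dγ`. -/
theorem lintegral_sub_rotation_le {n : ℕ} {f : Eucl n → ℝ} (hf : ContDiff ℝ 1 f) {θ : ℝ}
    (hθ : 0 ≤ θ) :
    ∫⁻ x, ∫⁻ z, ‖f (Real.cos θ • x + Real.sin θ • z) - f x‖ₑ ^ 2 ∂gauss n ∂gauss n ≤
      ENNReal.ofReal θ ^ 2 * ∫⁻ x, ‖gradient f x‖ₑ ^ 2 ∂gauss n := by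
  set h : Eucl n × Eucl n → ℝ → ℝ := fun p t =>
    inner ℝ (gradient f (Real.cos t • p.1 + Real.sin t • p.2))
      (-Real.sin t • p.1 + Real.cos t • p.2) with hh
  have hgc : Continuous (gradient f) :=
    (InnerProductSpace.toDual ℝ (Eucl n)).symm.continuous.comp (hf.continuous_fderiv (by simp))
  have hcont : Continuous (Function.uncurry h) := by
    simp only [hh, Function.uncurry_def]
    fun_prop
  have hder : ∀ p t, HasDerivAt (fun t => f (Real.cos t • p.1 + Real.sin t • p.2)) (h p t) t := by
    intro p t
    have h1 : HasDerivAt (fun t => Real.cos t • p.1 + Real.sin t • p.2)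
        (-Real.sin t • p.1 + Real.cos t • p.2) t :=
      ((Real.hasDerivAt_cos t).smul_const p.1).add ((Real.hasDerivAt_sin t).smul_const p.2)
    have h2 := ((hf.differentiable (by simp)) (Real.cos t • p.1 + Real.sin t • p.2)).hasGradientAt
    have := h2.hasFDerivAt.comp_hasDerivAt t h1
    refine this.congr_deriv ?_
    simp [hh]
  -- Fundamental theorem of calculus along the path, then Cauchy–Schwarz against the constant `1` on
  -- `(0, θ]`.
  have hpt : ∀ p : Eucl n × Eucl n,
      ‖f (Real.cos θ • p.1 + Real.sin θ • p.2) - f p.1‖ₑ ^ 2 ≤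
        ENNReal.ofReal θ * ∫⁻ t in Ioc 0 θ, ‖h p t‖ₑ ^ 2 := by
    intro p
    have hc : Continuous (h p) := hcont.uncurry_left p
    have h1 := intervalIntegral.integral_eq_sub_of_hasDerivAt
      (fun t _ => hder p t) (hc.intervalIntegrable 0 θ)
    simp only [Real.cos_zero, Real.sin_zero, one_smul, zero_smul, add_zero] at h1
    rw [← h1, intervalIntegral.integral_of_le hθ]
    calc _ ≤ (∫⁻ t in Ioc 0 θ, 1 * ‖h p t‖ₑ) ^ 2 := by
          gcongr; simpa using enorm_integral_le_lintegral_enorm _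
      _ ≤ _ := lintegral_mul_sq_le aemeasurable_const hc.enorm.aemeasurable
      _ = _ := by simp
  -- Undo the rotation, then integrate out the velocity first, using that the covariance is the
  -- identity.
  have hslice : ∀ t, ∫⁻ p, ‖h p t‖ₑ ^ 2 ∂(gauss n).prod (gauss n) =
      ∫⁻ x, ‖gradient f x‖ₑ ^ 2 ∂gauss n := by
    intro t
    have hm : Measurable fun p : Eucl n × Eucl n => ‖inner ℝ (gradient f p.1) p.2‖ₑ ^ 2 :=
      ((hgc.comp continuous_fst).inner continuous_snd).enorm.measurable.pow_const 2
    have := (measurePreserving_rotation n t).lintegral_comp hm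
    refine this.trans ?_
    rw [lintegral_prod _ hm.aemeasurable]
    simp_rw [lintegral_inner_sq]
  have hm1 : Measurable (Function.uncurry fun p t => ‖h p t‖ₑ ^ 2) :=
    hcont.enorm.measurable.pow_const 2
  have hm0 : Measurable fun p : Eucl n × Eucl n =>
      ‖f (Real.cos θ • p.1 + Real.sin θ • p.2) - f p.1‖ₑ ^ 2 := by
    have := hf.continuous
    exact Measurable.pow_const (Continuous.measurable (by fun_prop)) 2
  rw [← lintegral_prod _ hm0.aemeasurable]
  calc _ ≤ ∫⁻ p, (ENNReal.ofReal θ * ∫⁻ t in Ioc 0 θ, ‖h p t‖ₑ ^ 2) ∂(gauss n).prod (gauss n) :=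
        lintegral_mono hpt
    _ = ENNReal.ofReal θ * ∫⁻ t in Ioc 0 θ, ∫⁻ p, ‖h p t‖ₑ ^ 2 ∂(gauss n).prod (gauss n) := by
        rw [lintegral_const_mul' _ _ (by simp), lintegral_lintegral_swap hm1.aemeasurable]
    _ = _ := by
        simp_rw [hslice]
        simp only [lintegral_const, Measure.restrict_apply MeasurableSet.univ, univ_inter,
          Real.volume_Ioc, sub_zero]
        ring

/-- The Mehler (Ornstein-Uhlenbeck) average of `f` at angle `θ`. -/
def mehler (n : ℕ) (θ : ℝ) (f : Eucl n → ℝ) (x : Eucl n) : ℝ :=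
  ∫ z, f (Real.cos θ • x + Real.sin θ • z) ∂gauss n

theorem IsTestFunction.exists_bound {F : Type*} [NormedAddCommGroup F] [NormedSpace ℝ F]
    {U : Set F} {φ : F → ℝ} (hφ : IsTestFunction U φ) : ∃ C, ∀ x, ‖φ x‖ ≤ C :=
  hφ.2.1.exists_bound_of_continuous hφ.1.continuous

theorem enorm_integral_sq_le {α : Type*} [MeasurableSpace α] {μ : Measure α}
    [IsProbabilityMeasure μ] {f : α → ℝ} (hf : AEStronglyMeasurable f μ) :
    ‖∫ x, f x ∂μ‖ₑ ^ 2 ≤ ∫⁻ x, ‖f x‖ₑ ^ 2 ∂μ :=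
  calc _ ≤ (∫⁻ x, 1 * ‖f x‖ₑ ∂μ) ^ 2 := by
        gcongr; simpa using enorm_integral_le_lintegral_enorm _
    _ ≤ _ := lintegral_mul_sq_le aemeasurable_const hf.enorm
    _ = _ := by simp

theorem IsTestFunction.integrable_gauss {n : ℕ} {U : Set (Eucl n)} {φ : Eucl n → ℝ}
    (hφ : IsTestFunction U φ) (x : Eucl n) (c s : ℝ) :
    Integrable (fun z => φ (c • x + s • z)) (gauss n) := by
  obtain ⟨C, hC⟩ := hφ.exists_bound
  have := hφ.1.continuous
  exact Integrable.of_bound (Continuous.aestronglyMeasurable (by fun_prop)) C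
    (Eventually.of_forall fun z => hC _)

/-- Jensen's inequality in the averaged variable `z` reduces this to the rotation estimate. -/
theorem lintegral_sub_mehler_le {n : ℕ} {U : Set (Eucl n)} {φ : Eucl n → ℝ}
    (hφ : IsTestFunction U φ) {θ : ℝ} (hθ : 0 ≤ θ) :
    ∫⁻ x, ‖φ x - mehler n θ φ x‖ₑ ^ 2 ∂gauss n ≤
      ENNReal.ofReal θ ^ 2 * ∫⁻ x, ‖gradient φ x‖ₑ ^ 2 ∂gauss n := by
  refine le_trans (lintegral_mono fun x => ?_)
    (lintegral_sub_rotation_le (hφ.1.of_le (by simp)) hθ)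
  have hi := hφ.integrable_gauss x (Real.cos θ) (Real.sin θ)
  have h1 : mehler n θ φ x - φ x =
      ∫ z, (φ (Real.cos θ • x + Real.sin θ • z) - φ x) ∂gauss n := by
    rw [integral_sub hi (integrable_const _)]; simp [mehler]
  rw [← enorm_neg, neg_sub, h1]
  exact enorm_integral_sq_le (hi.1.sub aestronglyMeasurable_const)

theorem lintegral_enorm_sq {α : Type*} [MeasurableSpace α] {μ : Measure α} {f : α → ℝ}
    (hf : Integrable (fun x => f x ^ 2) μ) :
    ∫⁻ x, ‖f x‖ₑ ^ 2 ∂μ = ENNReal.ofReal (∫ x, f x ^ 2 ∂μ) := by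
  rw [ofReal_integral_eq_lintegral_ofReal hf (Eventually.of_forall fun x => sq_nonneg _)]
  refine lintegral_congr fun x => ?_
  rw [← ofReal_norm, ← ENNReal.ofReal_pow (norm_nonneg _), Real.norm_eq_abs, sq_abs]

/-- At `θ = π/2` the Mehler average is the mean `m`, so the variance of `φ` is bounded by the
gradient term. As `φ` lives in `Ω`, Cauchy–Schwarz against the indicator of `Ω` gives `m² ≤ γ(Ω) ∫
φ²`, so the variance is at least `(1 - γ(Ω)) ∫ φ²`. -/
theorem poincare_test {n : ℕ} {Ω : Opens (Eucl n)} {φ : Eucl n → ℝ}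
    (hφ : IsTestFunction (Ω : Set (Eucl n)) φ) :
    (1 - gauss n (Ω : Set (Eucl n))) * ∫⁻ x, ‖φ x‖ₑ ^ 2 ∂gauss n ≤
      ENNReal.ofReal (Real.pi / 2) ^ 2 * ∫⁻ x, ‖gradient φ x‖ₑ ^ 2 ∂gauss n := by
  have hint : Integrable φ (gauss n) := by simpa using hφ.integrable_gauss 0 0 1
  have hsq : Integrable (fun x => φ x ^ 2) (gauss n) := by
    obtain ⟨C, hC⟩ := hφ.exists_bound
    refine Integrable.of_bound (hφ.1.continuous.pow 2).aestronglyMeasurable (C ^ 2)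
      (Eventually.of_forall fun z => ?_)
    rw [norm_pow]; gcongr; exact hC z
  set m := ∫ x, φ x ∂gauss n with hm
  have hmean : mehler n (Real.pi / 2) φ = fun _ => m := by
    ext x; simp [mehler, hm]
  have h1 := lintegral_sub_mehler_le hφ (θ := Real.pi / 2) (by positivity)
  rw [hmean] at h1
  refine le_trans ?_ h1
  have hsupp : ∀ x, x ∉ (Ω : Set (Eucl n)) → φ x = 0 := fun x hx =>
    image_eq_zero_of_notMem_tsupport fun h => hx (hφ.2.2 h)
  set g := (gauss n).real (Ω : Set (Eucl n)) with hg
  have hm2 : m ^ 2 ≤ g * ∫ x, φ x ^ 2 ∂gauss n := by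
    have h2 : ∫⁻ x, ‖φ x‖ₑ ∂gauss n =
        ∫⁻ x, (Ω : Set (Eucl n)).indicator 1 x * ‖φ x‖ₑ ∂gauss n := by
      refine lintegral_congr fun x => ?_
      by_cases hx : x ∈ (Ω : Set (Eucl n))
      · simp [hx]
      · simp [hsupp x hx]
    have h3 : ‖m‖ₑ ^ 2 ≤ gauss n (Ω : Set (Eucl n)) * ∫⁻ x, ‖φ x‖ₑ ^ 2 ∂gauss n :=
      calc _ ≤ (∫⁻ x, ‖φ x‖ₑ ∂gauss n) ^ 2 := by
            gcongr; exact enorm_integral_le_lintegral_enorm _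
        _ ≤ _ := h2 ▸ lintegral_mul_sq_le
            (measurable_one.indicator Ω.isOpen.measurableSet).aemeasurable hint.1.enorm
        _ = _ := by
            congr 1
            rw [← lintegral_indicator_one Ω.isOpen.measurableSet]
            refine lintegral_congr fun x => ?_
            by_cases hx : x ∈ (Ω : Set (Eucl n)) <;> simp [hx]
    rw [lintegral_enorm_sq hsq, ← ofReal_norm, ← ENNReal.ofReal_pow (norm_nonneg _), Real.norm_eq_abs, sq_abs,
      ← ofReal_measureReal, ← ENNReal.ofReal_mul measureReal_nonneg] at h3
    exact (ENNReal.ofReal_le_ofReal_iff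
      (mul_nonneg measureReal_nonneg (integral_nonneg fun x => sq_nonneg _))).1 h3
  have h5 : ∫ x, (φ x - m) ^ 2 ∂gauss n = (∫ x, φ x ^ 2 ∂gauss n) - m ^ 2 := by
    have : ∀ x, (φ x - m) ^ 2 = φ x ^ 2 - (2 * m) * φ x + m ^ 2 := fun x => by ring
    simp_rw [this]
    rw [integral_add (f := fun x => φ x ^ 2 - 2 * m * φ x) (hsq.sub (hint.const_mul _))
      (integrable_const _), integral_sub hsq (hint.const_mul _), integral_const_mul, ← hm]
    simp
    ring
  have hsq' : Integrable (fun x => (φ x - m) ^ 2) (gauss n) := by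
    have : ∀ x, (φ x - m) ^ 2 = φ x ^ 2 - (2 * m) * φ x + m ^ 2 := fun x => by ring
    simp_rw [this]
    exact (hsq.sub (hint.const_mul _)).add (integrable_const _)
  rw [lintegral_enorm_sq hsq, lintegral_enorm_sq hsq', h5, ← ofReal_measureReal, ← ENNReal.ofReal_one,
    ← ENNReal.ofReal_sub _ measureReal_nonneg, ← ENNReal.ofReal_mul
      (sub_nonneg.2 measureReal_le_one)]
  refine ENNReal.ofReal_le_ofReal ?_
  linarith

/-! ### Compactness of the Mehler average -/

/-- The operator `f ↦ (x ↦ ⟪f, κ x⟫)` defined by a square integrable Hilbert-valued kernel. -/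
def kernelOp {X H : Type*} [MeasurableSpace X] (μ : Measure X) [NormedAddCommGroup H]
    [InnerProductSpace ℝ H] : Lp H 2 μ →L[ℝ] H →L[ℝ] Lp ℝ 2 μ :=
  (ContinuousLinearMap.compLpL₂ 2 μ (innerSL ℝ : H →L[ℝ] H →L[ℝ] ℝ)).flip

theorem coeFn_kernelOp {X H : Type*} [MeasurableSpace X] {μ : Measure X} [NormedAddCommGroup H]
    [InnerProductSpace ℝ H] (κ : Lp H 2 μ) (f : H) :
    kernelOp μ κ f =ᵐ[μ] fun x => inner ℝ f (κ x) :=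
  ContinuousLinearMap.coeFn_compLpL (p := 2) (μ := μ) (innerSL ℝ f : H →L[ℝ] ℝ) κ

/-- Kernels `c · 1_t` give operators of rank at most one. Sums of compact operators are compact, and
norm limits of them are compact; since the operator depends continuously on the kernel,
`Lp.induction` covers all square integrable kernels. -/
theorem isCompactOperator_kernelOp {X H : Type*} [MeasurableSpace X] {μ : Measure X}
    [NormedAddCommGroup H] [InnerProductSpace ℝ H] (κ : Lp H 2 μ) :
    IsCompactOperator (kernelOp μ κ) := by
  refine Lp.induction (by simp : (2 : ℝ≥0∞) ≠ ⊤)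
    (motive := fun κ : Lp H 2 μ => IsCompactOperator (kernelOp μ κ)) ?_ ?_ ?_ κ
  · intro c t hs hμs
    set u : Lp ℝ 2 μ := indicatorConstLp 2 hs hμs.ne (1 : ℝ) with hu
    have h1 : kernelOp μ (Lp.simpleFunc.indicatorConst 2 hs hμs.ne c : Lp H 2 μ) =
        (ContinuousLinearMap.toSpanSingleton ℝ u).comp (innerSL ℝ c) := by
      ext1 f
      refine Lp.ext ?_
      filter_upwards [coeFn_kernelOp
        (Lp.simpleFunc.indicatorConst 2 hs hμs.ne c : Lp H 2 μ) f,
        indicatorConstLp_coeFn (p := 2) (hs := hs) (hμs := hμs.ne) (c := c),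
        indicatorConstLp_coeFn (p := 2) (hs := hs) (hμs := hμs.ne) (c := (1 : ℝ)),
        Lp.coeFn_smul (inner ℝ c f) u] with x h1 h2 h3 h4
      rw [h1, Lp.simpleFunc.coe_indicatorConst, h2]
      simp only [ContinuousLinearMap.comp_apply, innerSL_apply_apply,
        ContinuousLinearMap.toSpanSingleton_apply]
      rw [h4, Pi.smul_apply, h3]
      by_cases hx : x ∈ t <;> simp [hx, real_inner_comm]
    rw [h1]
    exact IsCompactOperator.comp_clm (f := ContinuousLinearMap.toSpanSingleton ℝ u)
      (isCompactOperator_of_locallyCompactSpace_rng _) _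
  · intro f g hf hg _ h1 h2
    rw [map_add]
    exact h1.add h2
  · exact isClosed_setOfPred_isCompactOperator.preimage (kernelOp μ).continuous

/-- The Mehler kernel at angle `θ` with respect to the Gaussian measure. -/
def mehlerKernel (n : ℕ) (θ : ℝ) (x w : Eucl n) : ℝ :=
  (Real.sin θ ^ n)⁻¹ *
    Real.exp (-‖w - Real.cos θ • x‖ ^ 2 / (2 * Real.sin θ ^ 2) + ‖w‖ ^ 2 / 2)

theorem continuous_mehlerKernel (n : ℕ) (θ : ℝ) :
    Continuous (Function.uncurry (mehlerKernel n θ)) := by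
  unfold mehlerKernel Function.uncurry; fun_prop

/-- Substitute `w = cos θ x + sin θ z`. The Jacobian is `(sin θ)^(-n)`, and the factor `exp(‖w‖²/2)`
in the kernel compensates for integrating against `γ` in `w`. -/
theorem mehler_eq_integral_kernel {n : ℕ} {θ : ℝ} (hs : 0 < Real.sin θ) (φ : Eucl n → ℝ)
    (x : Eucl n) : mehler n θ φ x = ∫ w, mehlerKernel n θ x w * φ w ∂gauss n := by
  have hg : ∀ f : Eucl n → ℝ, ∫ z, f z ∂gauss n = ∫ z, gaussDensity n z * f z := by
    intro f
    rw [gauss, integral_withDensity_eq_integral_toReal_smul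
      (continuous_gaussDensity.measurable.ennreal_ofReal) (by simp)]
    simp [ENNReal.toReal_ofReal (gaussDensity_pos _).le]
  set c := Real.cos θ
  set s := Real.sin θ
  rw [mehler, hg, hg]
  have h1 := Measure.integral_comp_smul (volume : Measure (Eucl n))
    (fun u => gaussDensity n (s⁻¹ • u) * φ (c • x + u)) s
  simp only [smul_smul, inv_mul_cancel₀ hs.ne', one_smul] at h1
  rw [h1, ← integral_sub_right_eq_self _ (c • x), ← integral_smul]
  refine integral_congr_ae (Eventually.of_forall fun w => ?_)
  simp only [add_sub_cancel, smul_eq_mul, gaussDensity, mehlerKernel, finrank_euclideanSpace,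
    Fintype.card_fin]
  have h2 : ‖s⁻¹ • (w - c • x)‖ ^ 2 = ‖w - c • x‖ ^ 2 / s ^ 2 := by
    rw [norm_smul, mul_pow, Real.norm_eq_abs, sq_abs]; field_simp
  rw [abs_of_pos (by positivity), h2]
  have h3 : Real.exp (-‖w‖ ^ 2 / 2) *
      Real.exp (-‖w - c • x‖ ^ 2 / (2 * s ^ 2) + ‖w‖ ^ 2 / 2) =
      Real.exp (-(‖w - c • x‖ ^ 2 / s ^ 2) / 2) := by
    rw [← Real.exp_add]; congr 1; field_simp; ring
  rw [← h3]
  ring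

/-- The Hilbert–Schmidt property in pointwise form: the squared kernel with both Gaussian weights is
bounded by a product of a Gaussian in `x` and a Gaussian in `w`. The two exponents differ by exactly
`cos θ ‖w - x‖² / sin² θ`, which is nonnegative. -/
theorem mehlerKernel_sq_le {n : ℕ} {θ : ℝ} (hs : 0 < Real.sin θ) (hc : 0 ≤ Real.cos θ)
    (x w : Eucl n) :
    mehlerKernel n θ x w ^ 2 * gaussDensity n w * gaussDensity n x ≤
      ((Real.sin θ ^ n)⁻¹ * (2 * Real.pi) ^ (-(n : ℝ) / 2)) ^ 2 *
        (Real.exp (-((1 - Real.cos θ) ^ 2 / (2 * Real.sin θ ^ 2)) * ‖x‖ ^ 2) *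
        Real.exp (-((1 - Real.cos θ) ^ 2 / (2 * Real.sin θ ^ 2)) * ‖w‖ ^ 2)) := by
  have hsc := Real.sin_sq_add_cos_sq θ
  unfold mehlerKernel gaussDensity
  set c := Real.cos θ
  set s := Real.sin θ
  set b := (2 * Real.pi) ^ (-(n : ℝ) / 2)
  have h1 : ‖w - c • x‖ ^ 2 = ‖w‖ ^ 2 - 2 * c * inner ℝ w x + c ^ 2 * ‖x‖ ^ 2 := by
    rw [norm_sub_sq_real, inner_smul_right, norm_smul, mul_pow, Real.norm_eq_abs, sq_abs]; ring
  have h2 : ‖w - x‖ ^ 2 = ‖w‖ ^ 2 - 2 * inner ℝ w x + ‖x‖ ^ 2 := norm_sub_sq_real w x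
  have h3 : 2 * (-‖w - c • x‖ ^ 2 / (2 * s ^ 2) + ‖w‖ ^ 2 / 2) + -‖w‖ ^ 2 / 2 + -‖x‖ ^ 2 / 2 ≤
      -((1 - c) ^ 2 / (2 * s ^ 2)) * ‖x‖ ^ 2 + -((1 - c) ^ 2 / (2 * s ^ 2)) * ‖w‖ ^ 2 := by
    have h4 : 0 ≤ 2 * c * ‖w - x‖ ^ 2 / (2 * s ^ 2) := by positivity
    refine sub_nonneg.1 (h4.trans_eq ?_)
    rw [h1, h2]
    field_simp
    have : s ^ 2 = 1 - c ^ 2 := by linarith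
    rw [this]
    ring
  calc _ = ((s ^ n)⁻¹ * b) ^ 2 * Real.exp
        (2 * (-‖w - c • x‖ ^ 2 / (2 * s ^ 2) + ‖w‖ ^ 2 / 2) + -‖w‖ ^ 2 / 2 + -‖x‖ ^ 2 / 2) := by
        generalize -‖w - c • x‖ ^ 2 / (2 * s ^ 2) + ‖w‖ ^ 2 / 2 = e
        rw [Real.exp_add, Real.exp_add, two_mul, Real.exp_add]
        ring
    _ ≤ _ := by
        rw [← Real.exp_add]
        gcongr

theorem lintegral_gauss {n : ℕ} (f : Eucl n → ℝ≥0∞) :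
    ∫⁻ x, f x ∂gauss n = ∫⁻ x, ENNReal.ofReal (gaussDensity n x) * f x :=
  lintegral_withDensity_eq_lintegral_mul_non_measurable _
    continuous_gaussDensity.measurable.ennreal_ofReal (by simp) f

theorem integrable_exp_neg_mul_sq (n : ℕ) {k : ℝ} (hk : 0 < k) :
    Integrable fun x : Eucl n => Real.exp (-k * ‖x‖ ^ 2) := by
  have := (GaussianFourier.integrable_cexp_neg_mul_sq_norm_add (V := Eucl n)
    (b := k) (by simpa using hk) 0 0).norm
  refine this.congr (Eventually.of_forall fun x => ?_)
  simp only [Complex.norm_exp]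
  congr 1
  simp [← Complex.ofReal_pow]

theorem enorm_sq_eq_ofReal (r : ℝ) : ‖r‖ₑ ^ 2 = ENNReal.ofReal (r ^ 2) := by
  rw [← ofReal_norm, ← ENNReal.ofReal_pow (norm_nonneg _), Real.norm_eq_abs, sq_abs]

theorem exists_mehlerKernel_bound (n : ℕ) {θ : ℝ} (h0 : 0 < θ) (h1 : θ < Real.pi / 2) :
    ∃ C k : ℝ, 0 ≤ C ∧ 0 < k ∧ ∀ x w : Eucl n,
      mehlerKernel n θ x w ^ 2 * gaussDensity n w * gaussDensity n x ≤
        C * (Real.exp (-k * ‖x‖ ^ 2) * Real.exp (-k * ‖w‖ ^ 2)) := by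
  have hs : 0 < Real.sin θ := Real.sin_pos_of_pos_of_lt_pi h0 (by linarith [Real.pi_pos])
  have hc : 0 < Real.cos θ := Real.cos_pos_of_mem_Ioo ⟨by linarith [Real.pi_pos], h1⟩
  have hc1 : Real.cos θ < 1 := by nlinarith [Real.sin_sq_add_cos_sq θ, Real.cos_le_one θ]
  refine ⟨_, _, sq_nonneg _, ?_, fun x w => mehlerKernel_sq_le hs hc.le x w⟩
  have := sub_pos.2 hc1
  positivity

/-- On a ball the weight in `x` is bounded below and can be divided out. What remains is a majorant
in `w`, uniform over the ball, as dominated convergence needs. -/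
theorem mehlerKernel_dominated (n : ℕ) {θ : ℝ} (h0 : 0 < θ) (h1 : θ < Real.pi / 2) (R : ℝ) :
    ∃ C k : ℝ, 0 < k ∧ ∀ x w : Eucl n, ‖x‖ ≤ R →
      mehlerKernel n θ x w ^ 2 * gaussDensity n w ≤ C * Real.exp (-k * ‖w‖ ^ 2) := by
  obtain ⟨C, k, hC, hk, h⟩ := exists_mehlerKernel_bound n h0 h1
  set b := (2 * Real.pi) ^ (-(n : ℝ) / 2) * Real.exp (-R ^ 2 / 2) with hb
  have hbpos : 0 < b := by positivity
  refine ⟨C / b, k, hk, fun x w hx => ?_⟩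
  have hbx : b ≤ gaussDensity n x := by
    unfold gaussDensity
    rw [hb]
    have : ‖x‖ ^ 2 ≤ R ^ 2 := by gcongr
    gcongr
  rw [div_mul_eq_mul_div, le_div_iff₀ hbpos]
  have hnn : 0 ≤ mehlerKernel n θ x w ^ 2 * gaussDensity n w :=
    mul_nonneg (sq_nonneg _) (gaussDensity_pos w).le
  calc _ ≤ _ := mul_le_mul_of_nonneg_left hbx hnn
    _ ≤ _ := h x w
    _ ≤ C * (1 * Real.exp (-k * ‖w‖ ^ 2)) := by
        gcongr
        rw [Real.exp_le_one_iff]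
        nlinarith [sq_nonneg ‖x‖]
    _ = _ := by ring

theorem memLp_mehlerKernel (n : ℕ) {θ : ℝ} (h0 : 0 < θ) (h1 : θ < Real.pi / 2) (x : Eucl n) :
    MemLp (mehlerKernel n θ x) 2 (gauss n) := by
  refine ⟨((continuous_mehlerKernel n θ).uncurry_left x).aestronglyMeasurable, ?_⟩
  obtain ⟨C, k, hk, h⟩ := mehlerKernel_dominated n h0 h1 ‖x‖
  have h2 : eLpNorm (mehlerKernel n θ x) 2 (gauss n) ^ 2 < ⊤ := by
    rw [eLpNorm_two_sq, lintegral_gauss]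
    refine lt_of_le_of_lt (lintegral_mono fun w => ?_)
      ((integrable_exp_neg_mul_sq n hk).const_mul C).lintegral_lt_top
    rw [enorm_sq_eq_ofReal, ← ENNReal.ofReal_mul (gaussDensity_pos w).le, mul_comm]
    exact ENNReal.ofReal_le_ofReal (h x w le_rfl)
  exact (ENNReal.pow_lt_top_iff.1 h2).resolve_right (by norm_num)

/-- The Mehler kernel as a map into `L²(Ω, γ)`. -/
def mehlerVec {n : ℕ} (Ω : Opens (Eucl n)) {θ : ℝ} (h0 : 0 < θ) (h1 : θ < Real.pi / 2)
    (x : Eucl n) : L2Gauss Ω :=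
  ((memLp_mehlerKernel n h0 h1 x).restrict (Ω : Set (Eucl n))).toLp _

/-- Dominated convergence. The continuity serves to make this `L²`-valued map strongly measurable.
-/
theorem continuous_mehlerVec {n : ℕ} (Ω : Opens (Eucl n)) {θ : ℝ} (h0 : 0 < θ)
    (h1 : θ < Real.pi / 2) : Continuous (mehlerVec Ω h0 h1) := by
  rw [continuous_iff_continuousAt]
  intro x₀
  -- The extra `1` makes the majorant valid for all `x` in the unit ball around `x₀`.
  obtain ⟨C, k, hk, h⟩ := mehlerKernel_dominated n h0 h1 (‖x₀‖ + 1)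
  rw [ContinuousAt, tendsto_iff_edist_tendsto_0]
  have h3 : Tendsto (fun x => ∫⁻ w, ENNReal.ofReal (gaussDensity n w) *
      ‖mehlerKernel n θ x w - mehlerKernel n θ x₀ w‖ₑ ^ 2) (𝓝 x₀) (𝓝 0) := by
    have h4 : Tendsto (fun x => ∫⁻ w, ENNReal.ofReal (gaussDensity n w) *
        ‖mehlerKernel n θ x w - mehlerKernel n θ x₀ w‖ₑ ^ 2) (𝓝 x₀)
        (𝓝 (∫⁻ _ : Eucl n, 0)) := by
      refine tendsto_lintegral_filter_of_dominated_convergence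
        -- The factor `4` comes from `(p - q)² ≤ 2p² + 2q²`, with both squares under the same
        -- majorant.
        (fun w => ENNReal.ofReal (4 * (C * Real.exp (-k * ‖w‖ ^ 2)))) ?_ ?_ ?_ ?_
      · refine Eventually.of_forall fun x => ?_
        have hx := (continuous_mehlerKernel n θ).uncurry_left x
        have hx₀ := (continuous_mehlerKernel n θ).uncurry_left x₀
        exact continuous_gaussDensity.measurable.ennreal_ofReal.mul
          ((hx.sub hx₀).enorm.measurable.pow_const 2)
      · filter_upwards [Metric.ball_mem_nhds x₀ one_pos] with x hx
        refine Eventually.of_forall fun w => ?_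
        have hxn : ‖x‖ ≤ ‖x₀‖ + 1 := by
          have := norm_le_norm_add_norm_sub' x x₀
          rw [mem_ball_iff_norm] at hx
          linarith
        rw [enorm_sq_eq_ofReal, ← ENNReal.ofReal_mul (gaussDensity_pos w).le]
        refine ENNReal.ofReal_le_ofReal ?_
        have e1 := h x w hxn
        have e2 := h x₀ w (by linarith)
        have e3 : (mehlerKernel n θ x w - mehlerKernel n θ x₀ w) ^ 2 ≤
            2 * mehlerKernel n θ x w ^ 2 + 2 * mehlerKernel n θ x₀ w ^ 2 := by
          nlinarith [sq_nonneg (mehlerKernel n θ x w + mehlerKernel n θ x₀ w)]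
        have e4 := mul_le_mul_of_nonneg_left e3 (gaussDensity_pos w).le
        linarith
      · exact (((integrable_exp_neg_mul_sq n hk).const_mul C).const_mul 4).lintegral_lt_top.ne
      · refine Eventually.of_forall fun w => ?_
        have hc : Continuous fun x => ENNReal.ofReal (gaussDensity n w) *
            ‖mehlerKernel n θ x w - mehlerKernel n θ x₀ w‖ₑ ^ 2 := by
          refine (ENNReal.continuous_const_mul ENNReal.ofReal_ne_top).comp ?_
          have := (continuous_mehlerKernel n θ).uncurry_right w
          exact (ENNReal.continuous_pow 2).comp (this.sub continuous_const).enorm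
        simpa using hc.tendsto x₀
    simpa using h4
  have h5 : Tendsto (fun x => edist (mehlerVec Ω h0 h1 x) (mehlerVec Ω h0 h1 x₀) ^ 2)
      (𝓝 x₀) (𝓝 0) := by
    refine tendsto_of_tendsto_of_tendsto_of_le_of_le tendsto_const_nhds h3
      (fun _ => zero_le) fun x => ?_
    simp only [mehlerVec]
    rw [Lp.edist_toLp_toLp, eLpNorm_two_sq, ← lintegral_gauss]
    exact lintegral_mono' Measure.restrict_le_self le_rfl
  have h6 := h5.ennrpow_const (1 / 2 : ℝ)
  rw [ENNReal.zero_rpow_of_pos (by norm_num)] at h6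
  refine h6.congr fun x => ?_
  rw [← ENNReal.rpow_natCast, ← ENNReal.rpow_mul]
  norm_num

/-- The product bound on the kernel makes the double integral factor into two finite Gaussian
integrals. -/
theorem memLp_mehlerVec {n : ℕ} (Ω : Opens (Eucl n)) {θ : ℝ} (h0 : 0 < θ)
    (h1 : θ < Real.pi / 2) : MemLp (mehlerVec Ω h0 h1) 2 (gaussOn Ω) := by
  refine ⟨(continuous_mehlerVec Ω h0 h1).aestronglyMeasurable, ?_⟩
  obtain ⟨C, k, hC, hk, h⟩ := exists_mehlerKernel_bound n h0 h1
  have hint := integrable_exp_neg_mul_sq n hk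
  have h2 : eLpNorm (mehlerVec Ω h0 h1) 2 (gaussOn Ω) ^ 2 < ⊤ := by
    rw [eLpNorm_two_sq]
    refine lt_of_le_of_lt (lintegral_mono' Measure.restrict_le_self le_rfl) ?_
    rw [lintegral_gauss]
    have h3 : ∀ x, ENNReal.ofReal (gaussDensity n x) * ‖mehlerVec Ω h0 h1 x‖ₑ ^ 2 ≤
        ENNReal.ofReal (C * Real.exp (-k * ‖x‖ ^ 2)) *
          ∫⁻ w : Eucl n, ENNReal.ofReal (Real.exp (-k * ‖w‖ ^ 2)) := by
      intro x
      rw [mehlerVec, Lp.enorm_toLp, eLpNorm_two_sq]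
      refine le_trans (mul_le_mul_right (lintegral_mono' Measure.restrict_le_self le_rfl) _) ?_
      rw [lintegral_gauss, ← lintegral_const_mul' _ _ ENNReal.ofReal_ne_top,
        ← lintegral_const_mul' _ _ ENNReal.ofReal_ne_top]
      refine lintegral_mono fun w => ?_
      rw [enorm_sq_eq_ofReal, ← ENNReal.ofReal_mul (gaussDensity_pos w).le,
        ← ENNReal.ofReal_mul (gaussDensity_pos x).le, ← ENNReal.ofReal_mul (by positivity)]
      refine ENNReal.ofReal_le_ofReal ?_
      have := h x w
      linarith
    refine lt_of_le_of_lt (lintegral_mono h3) ?_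
    rw [lintegral_mul_const' _ _ hint.lintegral_lt_top.ne]
    exact ENNReal.mul_lt_top (hint.const_mul C).lintegral_lt_top hint.lintegral_lt_top
  exact (ENNReal.pow_lt_top_iff.1 h2).resolve_right (by norm_num)

/-- The kernel is restricted to `Ω` in both variables. On functions supported in `Ω` this loses
nothing, so the operator agrees with the full Mehler average on test functions; those suffice, being
dense in `H¹₀(Ω, γ)`. -/
theorem exists_compact_mehler {n : ℕ} (Ω : Opens (Eucl n)) {θ : ℝ} (h0 : 0 < θ)
    (h1 : θ < Real.pi / 2) : ∃ T : L2Gauss Ω →L[ℝ] L2Gauss Ω, IsCompactOperator T ∧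
      ∀ φ, IsTestFunction (Ω : Set (Eucl n)) φ → ∀ f : L2Gauss Ω, f =ᵐ[gaussOn Ω] φ →
        T f =ᵐ[gaussOn Ω] mehler n θ φ := by
  have hs : 0 < Real.sin θ := Real.sin_pos_of_pos_of_lt_pi h0 (by linarith [Real.pi_pos])
  refine ⟨kernelOp _ ((memLp_mehlerVec Ω h0 h1).toLp _), isCompactOperator_kernelOp _, ?_⟩
  intro φ hφ f hf
  filter_upwards [coeFn_kernelOp ((memLp_mehlerVec Ω h0 h1).toLp _) f,
    (memLp_mehlerVec Ω h0 h1).coeFn_toLp] with x h2 h3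
  rw [h2, h3, L2.inner_def, mehler_eq_integral_kernel hs]
  have h4 : ∫ w, mehlerKernel n θ x w * φ w ∂gauss n =
      ∫ w, mehlerKernel n θ x w * φ w ∂gaussOn Ω := by
    refine (setIntegral_eq_integral_of_forall_compl_eq_zero fun w hw => ?_).symm
    rw [image_eq_zero_of_notMem_tsupport fun h => hw (hφ.2.2 h), mul_zero]
  rw [h4]
  refine integral_congr_ae ?_
  filter_upwards [hf, ((memLp_mehlerKernel n h0 h1 x).restrict (Ω : Set (Eucl n))).coeFn_toLp]
    with w hw hw2
  rw [mehlerVec, hw, hw2]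
  simp

/-! ### Duality with test functions, and estimates on `H¹₀(Ω, γ)` -/

theorem contDiff_gaussDensity (n : ℕ) : ContDiff ℝ ∞ (gaussDensity n) := by
  unfold gaussDensity
  exact contDiff_const.mul (((contDiff_norm_sq ℝ).neg.div_const 2).exp)

/-- The quotient of a function by the Gaussian density. -/
def ratio {n : ℕ} (ψ : Eucl n → ℝ) (x : Eucl n) : ℝ := ψ x / gaussDensity n x

theorem continuous_ratio {n : ℕ} {ψ : Eucl n → ℝ} (h : Continuous ψ) : Continuous (ratio ψ) :=
  h.div continuous_gaussDensity fun x => (gaussDensity_pos x).ne'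

theorem memLp_of_compactSupport {n : ℕ} (Ω : Opens (Eucl n)) {ψ : Eucl n → ℝ}
    (h : Continuous ψ) (hc : HasCompactSupport ψ) : MemLp ψ 2 (gaussOn Ω) := by
  obtain ⟨C, hC⟩ := hc.exists_bound_of_continuous h
  exact MemLp.of_bound h.aestronglyMeasurable C (Eventually.of_forall hC)

theorem memLp_ratio {n : ℕ} (Ω : Opens (Eucl n)) {ψ : Eucl n → ℝ}
    (h : Continuous ψ) (hc : HasCompactSupport ψ) : MemLp (ratio ψ) 2 (gaussOn Ω) := by
  refine memLp_of_compactSupport Ω (continuous_ratio h) ?_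
  refine hc.mono fun x hx hψ => hx ?_
  simp [ratio, hψ]

/-- The weak gradient is tested with Lebesgue measure, whereas slices live in `L²(Ω, γ)`. Dividing
the test function by the density passes from one pairing to the other. -/
theorem setIntegral_mul_eq_ratio {n : ℕ} (Ω : Opens (Eucl n)) (f ψ : Eucl n → ℝ) :
    ∫ x in (Ω : Set (Eucl n)), f x * ψ x = ∫ x, f x * ratio ψ x ∂gaussOn Ω := by
  rw [gaussOn, gauss, restrict_withDensity Ω.isOpen.measurableSet,
    integral_withDensity_eq_integral_toReal_smul
      (continuous_gaussDensity.measurable.ennreal_ofReal) (by simp)]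
  refine integral_congr_ae (Eventually.of_forall fun x => ?_)
  simp only [ENNReal.toReal_ofReal (gaussDensity_pos x).le, ratio, smul_eq_mul]
  have := (gaussDensity_pos x).ne'
  field_simp

theorem IsTestFunction.mul_gaussDensity {n : ℕ} {U : Set (Eucl n)} {φ : Eucl n → ℝ}
    (h : IsTestFunction U φ) : IsTestFunction U (fun x => φ x * gaussDensity n x) :=
  ⟨h.1.mul (contDiff_gaussDensity n), h.2.1.mul_right,
    (tsupport_mul_subset_left).trans h.2.2⟩

/-- The null set of heights where a slice identity fails depends on the test function, so countably
many test functions have to determine an element of `L²(Ω, γ)`. Separability of `L²` provides them.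
-/
theorem exists_determining_seq {n : ℕ} (Ω : Opens (Eucl n)) :
    ∃ φ : ℕ → Eucl n → ℝ, (∀ k, IsTestFunction (Ω : Set (Eucl n)) (φ k)) ∧
      ∀ f : Eucl n → ℝ, MemLp f 2 (gaussOn Ω) →
        (∀ k, ∫ x, f x * ratio (φ k) x ∂gaussOn Ω = 0) → f =ᵐ[gaussOn Ω] 0 := by
  have hmem : ∀ ψ : {ψ : Eucl n → ℝ // IsTestFunction (Ω : Set (Eucl n)) ψ},
      MemLp ψ.1 2 (gaussOn Ω) := fun ψ => memLp_of_compactSupport Ω ψ.2.1.continuous ψ.2.2.1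
  let ι : {ψ : Eucl n → ℝ // IsTestFunction (Ω : Set (Eucl n)) ψ} → L2Gauss Ω :=
    fun ψ => (hmem ψ).toLp ψ.1
  have : Fact ((2 : ℝ≥0∞) ≠ ⊤) := ⟨by simp⟩
  have : SecondCountableTopology (L2Gauss Ω) := inferInstance
  have : Nonempty (range ι) :=
    ⟨⟨_, ⟨⟨0, contDiff_const, HasCompactSupport.zero, by simp [tsupport]⟩, rfl⟩⟩⟩
  have hch : ∀ k, ∃ ψ, ι ψ = denseSeq (range ι) k := fun k => (denseSeq (range ι) k).2
  choose ψ hψ using hch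
  -- The density is inserted so that `ratio` returns the functions `ψ k`, which are dense among the
  -- test functions in `L²(Ω, γ)`.
  refine ⟨fun k x => (ψ k).1 x * gaussDensity n x, fun k => (ψ k).2.mul_gaussDensity, ?_⟩
  intro f hf h0
  have hr : ∀ k, ratio (fun x => (ψ k).1 x * gaussDensity n x) = (ψ k).1 := by
    intro k; ext x; simp [ratio, (gaussDensity_pos x).ne']
  simp only [hr] at h0
  have hin : ∀ χ, inner ℝ (ι χ) (hf.toLp f) = ∫ x, f x * χ.1 x ∂gaussOn Ω := by
    intro χ
    rw [L2.inner_def]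
    refine integral_congr_ae ?_
    filter_upwards [hf.coeFn_toLp, (hmem χ).coeFn_toLp] with x h1 h2
    rw [h1, h2]
    simp
  have hall : ∀ z : range ι, inner ℝ (z : L2Gauss Ω) (hf.toLp f) = 0 := by
    have hcl : IsClosed {z : range ι | inner ℝ (z : L2Gauss Ω) (hf.toLp f) = 0} :=
      isClosed_eq (by fun_prop) continuous_const
    intro z
    refine (hcl.closure_subset_iff.2 ?_) (denseRange_denseSeq (range ι) z)
    rintro _ ⟨k, rfl⟩
    rw [mem_ofPred_eq, ← hψ k, hin, h0]
  have hloc : LocallyIntegrableOn f (Ω : Set (Eucl n)) (gauss n) :=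
    IntegrableOn.locallyIntegrableOn (hf.integrable (by norm_num))
  have key := Ω.isOpen.ae_eq_zero_of_integral_contDiff_smul_eq_zero hloc fun g g1 g2 g3 => by
    have h1 := hall ⟨_, ⟨⟨g, g1, g2, g3⟩, rfl⟩⟩
    rw [hin] at h1
    rw [← h1, gaussOn, setIntegral_eq_integral_of_forall_compl_eq_zero]
    · simp [mul_comm]
    · intro x hx
      simp [image_eq_zero_of_notMem_tsupport fun h => hx (g3 h)]
  exact (ae_restrict_iff' Ω.isOpen.measurableSet).2 key

theorem tendsto_integral_mul_of_eLpNorm {α : Type*} [MeasurableSpace α] {μ : Measure α}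
    {f : ℕ → α → ℝ} {u r : α → ℝ} (hf : ∀ k, MemLp (f k) 2 μ) (hu : MemLp u 2 μ)
    (hr : MemLp r 2 μ) (h : Tendsto (fun k => eLpNorm (fun x => f k x - u x) 2 μ) atTop (𝓝 0)) :
    Tendsto (fun k => ∫ x, f k x * r x ∂μ) atTop (𝓝 (∫ x, u x * r x ∂μ)) := by
  have h1 : Tendsto (fun k => (hf k).toLp (f k)) atTop (𝓝 (hu.toLp u)) :=
    (Lp.tendsto_Lp_iff_tendsto_eLpNorm'' f hf u hu).2 h
  have h2 : ∀ (g : α → ℝ) (hg : MemLp g 2 μ),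
      inner ℝ (hr.toLp r) (hg.toLp g) = ∫ x, g x * r x ∂μ := by
    intro g hg
    rw [L2.inner_def]
    refine integral_congr_ae ?_
    filter_upwards [hg.coeFn_toLp, hr.coeFn_toLp] with x e1 e2
    rw [e1, e2]
    simp
  simp_rw [← h2 _ (hf _), ← h2 _ hu]
  exact tendsto_const_nhds.inner h1

/-- `T` is the operator on `L²(Ω, γ)` that extends the Mehler average at angle `θ`. -/
def IsMehler {n : ℕ} (Ω : Opens (Eucl n)) (θ : ℝ) (T : L2Gauss Ω →L[ℝ] L2Gauss Ω) : Prop :=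
  ∀ φ, IsTestFunction (Ω : Set (Eucl n)) φ → ∀ f : L2Gauss Ω, f =ᵐ[gaussOn Ω] φ →
    T f =ᵐ[gaussOn Ω] mehler n θ φ

theorem IsTestFunction.gradient_compactSupport {n : ℕ} {U : Set (Eucl n)} {φ : Eucl n → ℝ}
    (h : IsTestFunction U φ) : HasCompactSupport (gradient φ) := by
  refine (h.2.1.fderiv ℝ).mono fun x hx hd => hx ?_
  rw [gradient_eq, hd, map_zero]

theorem IsTestFunction.memLp_gradient {n : ℕ} {Ω : Opens (Eucl n)} {φ : Eucl n → ℝ}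
    (h : IsTestFunction (Ω : Set (Eucl n)) φ) : MemLp (gradient φ) 2 (gaussOn Ω) := by
  obtain ⟨C, hC⟩ := h.gradient_compactSupport.exists_bound_of_continuous h.memLp_two.2
  exact MemLp.of_bound h.memLp_two.2.aestronglyMeasurable C (Eventually.of_forall hC)

theorem IsTestFunction.memLp {n : ℕ} {Ω : Opens (Eucl n)} {φ : Eucl n → ℝ}
    (h : IsTestFunction (Ω : Set (Eucl n)) φ) : MemLp φ 2 (gaussOn Ω) :=
  memLp_of_compactSupport Ω h.1.continuous h.2.1

theorem IsTestFunction.fderiv_apply' {n : ℕ} {U : Set (Eucl n)} {φ : Eucl n → ℝ}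
    (h : IsTestFunction U φ) (e : Eucl n) : IsTestFunction U (fun x => fderiv ℝ φ x e) :=
  ⟨(h.1.fderiv_right (m := ∞) (by simp)).clm_apply contDiff_const, h.2.1.fderiv_apply ℝ e,
    (tsupport_fderiv_apply_subset ℝ e).trans h.2.2⟩

theorem lintegral_gaussOn_eq {n : ℕ} {Ω : Opens (Eucl n)} {E : Type*} [NormedAddCommGroup E]
    {f : Eucl n → E} (h : ∀ x, x ∉ (Ω : Set (Eucl n)) → f x = 0) :
    ∫⁻ x, ‖f x‖ₑ ^ 2 ∂gauss n = ∫⁻ x, ‖f x‖ₑ ^ 2 ∂gaussOn Ω := by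
  rw [gaussOn, setLIntegral_eq_of_support_subset]
  intro x hx
  by_contra hxΩ
  exact hx (by simp [h x hxΩ])

theorem IsTestFunction.gradient_eq_zero {n : ℕ} {U : Set (Eucl n)} {φ : Eucl n → ℝ}
    (h : IsTestFunction U φ) {x : Eucl n} (hx : x ∉ U) : gradient φ x = 0 := by
  have h1 : fderiv ℝ φ x = 0 := image_eq_zero_of_notMem_tsupport fun h' =>
    hx (h.2.2 (tsupport_fderiv_subset ℝ h'))
  rw [gradient_eq, h1, map_zero]

theorem IsTestFunction.norm_toLp_sq_le {n : ℕ} {Ω : Opens (Eucl n)} {φ : Eucl n → ℝ}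
    (h : IsTestFunction (Ω : Set (Eucl n)) φ) :
    (1 - (gauss n).real (Ω : Set (Eucl n))) * ‖h.memLp.toLp φ‖ ^ 2 ≤
      (Real.pi / 2) ^ 2 * ‖h.memLp_gradient.toLp (gradient φ)‖ ^ 2 := by
  have h1 := poincare_test h
  rw [lintegral_gaussOn_eq (f := φ) fun x hx =>
      image_eq_zero_of_notMem_tsupport fun h' => hx (h.2.2 h'),
    lintegral_gaussOn_eq (f := gradient φ) fun x hx => h.gradient_eq_zero hx,
    ← eLpNorm_two_sq, ← eLpNorm_two_sq, ← Lp.enorm_toLp h.memLp,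
    ← Lp.enorm_toLp h.memLp_gradient] at h1
  have h2 := ENNReal.toReal_mono (by finiteness) h1
  rw [ENNReal.toReal_mul, ENNReal.toReal_mul, ENNReal.toReal_pow, ENNReal.toReal_pow,
    ENNReal.toReal_pow, ENNReal.toReal_sub_of_le prob_le_one (by simp),
    ENNReal.toReal_ofReal (by positivity)] at h2
  simpa [Measure.real] using h2

theorem IsTestFunction.norm_sub_mehler_le {n : ℕ} {Ω : Opens (Eucl n)} {φ : Eucl n → ℝ}
    (h : IsTestFunction (Ω : Set (Eucl n)) φ) {θ : ℝ} (hθ : 0 ≤ θ)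
    {T : L2Gauss Ω →L[ℝ] L2Gauss Ω} (hT : IsMehler Ω θ T) :
    ‖h.memLp.toLp φ - T (h.memLp.toLp φ)‖ ≤ θ * ‖h.memLp_gradient.toLp (gradient φ)‖ := by
  have h1 := lintegral_sub_mehler_le h hθ
  rw [lintegral_gaussOn_eq (f := gradient φ) fun x hx => h.gradient_eq_zero hx,
    ← eLpNorm_two_sq (gradient φ), ← Lp.enorm_toLp h.memLp_gradient] at h1
  have h2 : ‖h.memLp.toLp φ - T (h.memLp.toLp φ)‖ₑ ^ 2 ≤
      ∫⁻ x, ‖φ x - mehler n θ φ x‖ₑ ^ 2 ∂gauss n := by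
    rw [Lp.enorm_def, eLpNorm_two_sq]
    refine le_trans (le_of_eq (lintegral_congr_ae ?_))
      (lintegral_mono' Measure.restrict_le_self le_rfl)
    filter_upwards [hT φ h _ h.memLp.coeFn_toLp, h.memLp.coeFn_toLp,
      Lp.coeFn_sub (h.memLp.toLp φ) (T (h.memLp.toLp φ))] with x e1 e2 e3
    rw [e3, Pi.sub_apply, e1, e2]
  have h3 := ENNReal.toReal_mono (by finiteness) (h2.trans h1)
  rw [ENNReal.toReal_mul, ENNReal.toReal_pow, ENNReal.toReal_pow,
    ENNReal.toReal_pow, ENNReal.toReal_ofReal hθ, toReal_enorm, toReal_enorm, ← mul_pow] at h3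
  exact le_of_sq_le_sq h3 (by positivity)

/-- Integration by parts, the Poincaré inequality and the Mehler estimate hold for test functions,
and all three survive the limits `φ k → u`, `∇(φ k) → g` in `L²`. The first property identifies `g`
as the weak gradient of `u`. -/
theorem MemH10.exists_gradient {n : ℕ} {Ω : Opens (Eucl n)} {u : L2Gauss Ω}
    (h : MemH10 Ω u) : ∃ g : Lp (Eucl n) 2 (gaussOn Ω),
      (∀ φ, IsTestFunction (Ω : Set (Eucl n)) φ → ∀ e : Eucl n,
        ∫ x, u x * ratio (fun x => fderiv ℝ φ x e) x ∂gaussOn Ω =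
          -∫ x, inner ℝ (g x) e * ratio φ x ∂gaussOn Ω) ∧
      (1 - (gauss n).real (Ω : Set (Eucl n))) * ‖u‖ ^ 2 ≤ (Real.pi / 2) ^ 2 * ‖g‖ ^ 2 ∧
      ∀ θ, 0 ≤ θ → ∀ T, IsMehler Ω θ T → ‖u - T u‖ ≤ θ * ‖g‖ := by
  obtain ⟨hu, g, hg, φ, h1, h2, h3⟩ := h
  have l1 : Tendsto (fun k => (h1 k).memLp.toLp (φ k)) atTop (𝓝 u) := by
    have := (Lp.tendsto_Lp_iff_tendsto_eLpNorm'' φ (fun k => (h1 k).memLp) u hu).2 h2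
    rwa [Lp.toLp_coeFn] at this
  have l2 : Tendsto (fun k => (h1 k).memLp_gradient.toLp (gradient (φ k))) atTop
      (𝓝 (hg.toLp g)) :=
    (Lp.tendsto_Lp_iff_tendsto_eLpNorm'' (fun k => gradient (φ k))
      (fun k => (h1 k).memLp_gradient) g hg).2 h3
  refine ⟨hg.toLp g, ?_, ?_, ?_⟩
  · intro ψ hψ e
    have hge : (fun x => inner ℝ (hg.toLp g x) e * ratio ψ x) =ᵐ[gaussOn Ω]
        fun x => inner ℝ (g x) e * ratio ψ x := by
      filter_upwards [hg.coeFn_toLp] with x hx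
      rw [hx]
    rw [integral_congr_ae hge]
    have hinner : ∀ {f : Eucl n → Eucl n}, MemLp f 2 (gaussOn Ω) →
        MemLp (fun x => inner ℝ (f x) e) 2 (gaussOn Ω) := fun hf => by
      simpa only [real_inner_comm] using hf.const_inner (𝕜 := ℝ) e
    have t1 := tendsto_integral_mul_of_eLpNorm (fun k => (h1 k).memLp) hu
      (memLp_ratio Ω (hψ.fderiv_apply' e).1.continuous (hψ.fderiv_apply' e).2.1) h2
    have t2 := tendsto_integral_mul_of_eLpNorm (f := fun k x => inner ℝ (gradient (φ k) x) e)
      (u := fun x => inner ℝ (g x) e) (fun k => hinner (h1 k).memLp_gradient)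
      (hinner hg) (memLp_ratio Ω hψ.1.continuous hψ.2.1) (by
        have hlim : Tendsto (fun k => ENNReal.ofReal ‖e‖ *
            eLpNorm (fun x => gradient (φ k) x - g x) 2 (gaussOn Ω)) atTop (𝓝 0) := by
          simpa only [mul_zero] using ENNReal.Tendsto.const_mul h3 (Or.inr ENNReal.ofReal_ne_top)
        refine tendsto_of_tendsto_of_tendsto_of_le_of_le tendsto_const_nhds hlim
          (fun _ => zero_le) fun k => ?_
        refine eLpNorm_le_mul_eLpNorm_of_ae_le_mul (Eventually.of_forall fun x => ?_) _
        rw [← inner_sub_left, mul_comm]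
        exact norm_inner_le_norm _ _)
    refine tendsto_nhds_unique t1 (t2.neg.congr fun k => ?_)
    have hz : ∀ {f χ : Eucl n → ℝ}, IsTestFunction (Ω : Set (Eucl n)) χ →
        ∫ x in (Ω : Set (Eucl n)), f x * χ x = ∫ x, f x * χ x := fun hχ => by
      refine setIntegral_eq_integral_of_forall_compl_eq_zero fun x hx => ?_
      rw [image_eq_zero_of_notMem_tsupport fun h => hx (hχ.2.2 h), mul_zero]
    rw [← setIntegral_mul_eq_ratio, ← setIntegral_mul_eq_ratio, hz hψ, hz (hψ.fderiv_apply' e)]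
    have hd := ((h1 k).fderiv_apply' e)
    rw [integral_mul_fderiv_eq_neg_fderiv_mul_of_integrable]
    · congr 1
      refine integral_congr_ae (Eventually.of_forall fun x => ?_)
      simp [gradient]
    · exact (hd.1.continuous.mul hψ.1.continuous).integrable_of_hasCompactSupport hψ.2.1.mul_left
    · exact ((h1 k).1.continuous.mul
        (hψ.fderiv_apply' e).1.continuous).integrable_of_hasCompactSupport (h1 k).2.1.mul_right
    · exact ((h1 k).1.continuous.mul hψ.1.continuous).integrable_of_hasCompactSupport
        hψ.2.1.mul_left
    · exact fun x _ => (h1 k).differentiable x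
    · exact fun x _ => hψ.differentiable x
  · exact le_of_tendsto_of_tendsto' ((l1.norm.pow 2).const_mul _) ((l2.norm.pow 2).const_mul _)
      fun k => (h1 k).norm_toLp_sq_le
  · intro θ hθ T hT
    exact le_of_tendsto_of_tendsto' (l1.sub ((T.continuous.tendsto u).comp l1)).norm
      (l2.norm.const_mul _) fun k => (h1 k).norm_sub_mehler_le hθ hT

/-! ### The weight `y^a` and slices of functions on the cylinder -/

theorem lintegral_powMeasure (a : ℝ) (f : ℝ → ℝ≥0∞) :
    ∫⁻ y, f y ∂powMeasure a = ∫⁻ y in Ioi 0, ENNReal.ofReal (y ^ a) * f y :=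
  lintegral_withDensity_eq_lintegral_mul_non_measurable _ (by fun_prop) (by simp) f

theorem ae_powMeasure_iff {a : ℝ} {p : ℝ → Prop} :
    (∀ᵐ y ∂powMeasure a, p y) ↔ ∀ᵐ y ∂(volume.restrict (Ioi (0 : ℝ))), p y := by
  rw [powMeasure, ae_withDensity_iff (by fun_prop), ae_restrict_iff' measurableSet_Ioi,
    ae_restrict_iff' measurableSet_Ioi]
  refine eventually_congr (Eventually.of_forall fun y => forall_congr' fun hy => ?_)
  have : 0 < y ^ a := Real.rpow_pos_of_pos hy a
  simp [this]

theorem lintegral_rpow_neg {a : ℝ} (ha : a < 1) {R : ℝ} (hR : 0 ≤ R) :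
    ∫⁻ t in Ioc 0 R, ENNReal.ofReal (t ^ (-a)) = ENNReal.ofReal (R ^ (1 - a) / (1 - a)) := by
  have hi : IntegrableOn (fun t : ℝ => t ^ (-a)) (Ioc 0 R) :=
    (intervalIntegrable_iff_integrableOn_Ioc_of_le hR).1
      (intervalIntegral.intervalIntegrable_rpow' (by linarith))
  rw [← ofReal_integral_eq_lintegral_ofReal hi, ← intervalIntegral.integral_of_le hR,
    integral_rpow (Or.inl (by linarith)), Real.zero_rpow (by linarith)]
  · congr 1
    rw [sub_zero]
    congr 1 <;> ring_nf
  · filter_upwards [ae_restrict_mem measurableSet_Ioc] with t ht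
    exact Real.rpow_nonneg ht.1.le _

/-- Write `g = t^(-a/2) · t^(a/2) g` and apply Cauchy–Schwarz; `a < 1` makes `t^(-a)` integrable at
`0`. This is where the rate of convergence to the trace comes from. -/
theorem setLIntegral_sq_le {a : ℝ} (ha : a < 1) {R : ℝ} (hR : 0 ≤ R) {g : ℝ → ℝ≥0∞}
    (hg : Measurable g) :
    (∫⁻ t in Ioc 0 R, g t) ^ 2 ≤
      ENNReal.ofReal (R ^ (1 - a) / (1 - a)) * ∫⁻ t, g t ^ 2 ∂powMeasure a := by
  have h1 : ∫⁻ t in Ioc 0 R, g t = ∫⁻ t in Ioc 0 R,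
      ENNReal.ofReal (t ^ (-a / 2)) * (ENNReal.ofReal (t ^ (a / 2)) * g t) := by
    refine setLIntegral_congr_fun measurableSet_Ioc fun t ht => ?_
    rw [← mul_assoc, ← ENNReal.ofReal_mul (Real.rpow_nonneg ht.1.le _), ← Real.rpow_add ht.1]
    have : -a / 2 + a / 2 = 0 := by ring
    simp [this]
  rw [h1]
  refine (lintegral_mul_sq_le (by fun_prop) (by fun_prop)).trans ?_
  have hpow : ∀ {t b : ℝ}, 0 < t → ENNReal.ofReal (t ^ (b / 2)) ^ 2 = ENNReal.ofReal (t ^ b) := by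
    intro t b ht
    rw [← ENNReal.ofReal_pow (Real.rpow_nonneg ht.le _), ← Real.rpow_natCast,
      ← Real.rpow_mul ht.le]
    congr 2
    push_cast
    ring
  refine mul_le_mul' ?_ ?_
  · rw [← lintegral_rpow_neg ha hR]
    refine le_of_eq (setLIntegral_congr_fun measurableSet_Ioc fun t ht => ?_)
    exact hpow ht.1
  · rw [lintegral_powMeasure]
    refine le_trans (le_of_eq (setLIntegral_congr_fun measurableSet_Ioc fun t ht => ?_))
      (lintegral_mono_set Ioc_subset_Ioi_self)
    rw [mul_pow, hpow ht.1]

section slices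

variable {n : ℕ} {Ω : Opens (Eucl n)} {a : ℝ} {E : Type*} [NormedAddCommGroup E]

theorem lintegral_slices {f : Eucl n × ℝ → E} (hf : StronglyMeasurable f) :
    ∫⁻ y, eLpNorm (fun x => f (x, y)) 2 (gaussOn Ω) ^ 2 ∂powMeasure a =
      eLpNorm f 2 (cylMeasure Ω a) ^ 2 := by
  simp_rw [eLpNorm_two_sq]
  rw [lintegral_prod_symm' _ (hf.enorm.pow_const 2)]

theorem measurable_eLpNorm_slice {f : Eucl n × ℝ → E} (hf : StronglyMeasurable f) :
    Measurable fun y => eLpNorm (fun x => f (x, y)) 2 (gaussOn Ω) ^ 2 := by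
  simp_rw [eLpNorm_two_sq]
  exact (hf.enorm.pow_const 2).lintegral_prod_left'

theorem memLp_slice {f : Eucl n × ℝ → E} (hf : StronglyMeasurable f)
    (h : MemLp f 2 (cylMeasure Ω a)) :
    ∀ᵐ y ∂(volume.restrict (Ioi (0 : ℝ))), MemLp (fun x => f (x, y)) 2 (gaussOn Ω) := by
  rw [← ae_powMeasure_iff (a := a)]
  have h1 := lintegral_slices (Ω := Ω) (a := a) hf
  have h2 := ae_lt_top (measurable_eLpNorm_slice (Ω := Ω) hf)
    (h1.trans_ne (ENNReal.pow_ne_top h.2.ne))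
  filter_upwards [h2] with y hy
  exact ⟨(hf.comp_measurable measurable_prodMk_right).aestronglyMeasurable,
    (ENNReal.pow_lt_top_iff.1 hy).resolve_right (by norm_num)⟩

/-- Integrability down to `y = 0` for the unweighted measure `dy`: Cauchy–Schwarz in `x`, then the
weighted inequality in `y`. It justifies Fubini's theorem for pairings with a fixed function of `x`.
-/
theorem integrable_mul_slab (ha : a < 1) {f : Eucl n × ℝ → ℝ} (hf : StronglyMeasurable f)
    (h : MemLp f 2 (cylMeasure Ω a)) {r : Eucl n → ℝ} (hrm : StronglyMeasurable r)
    (hr : MemLp r 2 (gaussOn Ω)) (R : ℝ) :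
    Integrable (fun z : Eucl n × ℝ => f z * r z.1)
      ((gaussOn Ω).prod (volume.restrict (Ioc 0 R))) := by
  rcases lt_or_ge R 0 with hR | hR
  · simp [Ioc_eq_empty (not_lt.2 hR.le)]
  have hm : StronglyMeasurable fun z : Eucl n × ℝ => f z * r z.1 :=
    hf.mul (hrm.comp_measurable measurable_fst)
  refine ⟨hm.aestronglyMeasurable, ?_⟩
  rw [HasFiniteIntegral, lintegral_prod_symm' _ hm.enorm]
  have h1 : (∫⁻ y in Ioc 0 R, ∫⁻ x, ‖f (x, y) * r x‖ₑ ∂gaussOn Ω) ^ 2 < ⊤ := by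
    refine lt_of_le_of_lt (setLIntegral_sq_le ha hR hm.enorm.lintegral_prod_left') ?_
    refine ENNReal.mul_lt_top ENNReal.ofReal_lt_top ?_
    have h2 : ∀ y, (∫⁻ x, ‖f (x, y) * r x‖ₑ ∂gaussOn Ω) ^ 2 ≤
        eLpNorm (fun x => f (x, y)) 2 (gaussOn Ω) ^ 2 * eLpNorm r 2 (gaussOn Ω) ^ 2 := by
      intro y
      rw [eLpNorm_two_sq, eLpNorm_two_sq]
      simp_rw [enorm_mul]
      exact lintegral_mul_sq_le
        (hf.comp_measurable measurable_prodMk_right).enorm.aemeasurable hrm.enorm.aemeasurable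
    refine lt_of_le_of_lt (lintegral_mono h2) ?_
    rw [lintegral_mul_const' _ _ (ENNReal.pow_ne_top hr.2.ne), lintegral_slices hf]
    exact ENNReal.mul_lt_top (ENNReal.pow_lt_top h.2) (ENNReal.pow_lt_top hr.2)
  exact (ENNReal.pow_lt_top_iff.1 h1).resolve_right (by norm_num)

theorem integrableOn_slab (ha : a < 1) {f : Eucl n × ℝ → ℝ} (hf : StronglyMeasurable f)
    (h : MemLp f 2 (cylMeasure Ω a)) {r : Eucl n → ℝ} (hrm : StronglyMeasurable r)
    (hr : MemLp r 2 (gaussOn Ω)) (R : ℝ) :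
    IntegrableOn (fun y => ∫ x, f (x, y) * r x ∂gaussOn Ω) (Ioc 0 R) :=
  (integrable_mul_slab ha hf h hrm hr R).integral_prod_right

/-- The primitive `∫₀^y p(x, t) dt` in the vertical variable. -/
def vertPrim (p : Eucl n × ℝ → ℝ) (y : ℝ) (x : Eucl n) : ℝ := ∫ t in Ioc 0 y, p (x, t)

theorem stronglyMeasurable_vertPrim {p : Eucl n × ℝ → ℝ} (hp : StronglyMeasurable p) (y : ℝ) :
    StronglyMeasurable (vertPrim p y) :=
  hp.integral_prod_right'

/-- The weighted inequality on each vertical line, integrated over `x`. -/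
theorem eLpNorm_vertPrim_le (ha : a < 1) {p : Eucl n × ℝ → ℝ} (hp : StronglyMeasurable p)
    {y : ℝ} (hy : 0 ≤ y) :
    eLpNorm (vertPrim p y) 2 (gaussOn Ω) ^ 2 ≤
      ENNReal.ofReal (y ^ (1 - a) / (1 - a)) * eLpNorm p 2 (cylMeasure Ω a) ^ 2 := by
  rw [eLpNorm_two_sq, eLpNorm_two_sq, lintegral_prod _ (hp.enorm.pow_const 2).aemeasurable,
    ← lintegral_const_mul' _ _ ENNReal.ofReal_ne_top]
  refine lintegral_mono fun x => ?_
  refine le_trans ?_ (setLIntegral_sq_le ha hy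
    (hp.comp_measurable measurable_prodMk_left).enorm)
  gcongr
  exact enorm_integral_le_lintegral_enorm _

theorem integral_vertPrim_mul (ha : a < 1) {p : Eucl n × ℝ → ℝ} (hp : StronglyMeasurable p)
    (h : MemLp p 2 (cylMeasure Ω a)) {r : Eucl n → ℝ} (hrm : StronglyMeasurable r)
    (hr : MemLp r 2 (gaussOn Ω)) (y : ℝ) :
    ∫ x, vertPrim p y x * r x ∂gaussOn Ω =
      ∫ t in Ioc 0 y, ∫ x, p (x, t) * r x ∂gaussOn Ω := by
  rw [← integral_integral_swap (integrable_mul_slab ha hp h hrm hr y)]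
  refine integral_congr_ae (Eventually.of_forall fun x => ?_)
  exact (integral_mul_const _ _).symm

end slices

/-! ### Product test functions and weak derivatives on the half-line -/

theorem tsupport_prod_mul_subset {X : Type*} [TopologicalSpace X] {A : X → ℝ} {B : ℝ → ℝ} :
    tsupport (fun z : X × ℝ => A z.1 * B z.2) ⊆ tsupport A ×ˢ tsupport B := by
  refine closure_minimal (fun z hz => ?_) ((isClosed_tsupport A).prod (isClosed_tsupport B))
  exact ⟨subset_tsupport A (left_ne_zero_of_mul hz), subset_tsupport B (right_ne_zero_of_mul hz)⟩

theorem hasCompactSupport_prod_mul {X : Type*} [TopologicalSpace X] {A : X → ℝ} {B : ℝ → ℝ}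
    (hA : HasCompactSupport A) (hB : HasCompactSupport B) :
    HasCompactSupport (fun z : X × ℝ => A z.1 * B z.2) :=
  (IsCompact.prod hA hB).of_isClosed_subset (isClosed_tsupport _) tsupport_prod_mul_subset

theorem IsTestFunction.prod_mul {n : ℕ} {Ω : Opens (Eucl n)} {φ : Eucl n → ℝ} {ψ : ℝ → ℝ}
    (hφ : IsTestFunction (Ω : Set (Eucl n)) φ) (hψ : IsTestFunction (Ioi 0) ψ) :
    IsTestFunction (cylinder Ω) (fun z => φ z.1 * ψ z.2) :=
  ⟨(hφ.1.comp contDiff_fst).mul (hψ.1.comp contDiff_snd),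
    hasCompactSupport_prod_mul hφ.2.1 hψ.2.1,
    tsupport_prod_mul_subset.trans (prod_mono hφ.2.2 hψ.2.2)⟩

/-- Fubini's theorem separates the variables: a weak identity on the cylinder becomes one on the
half-line for the pairing of the slices with a fixed `A`. -/
theorem integral_cylinder_prod_mul {n : ℕ} {Ω : Opens (Eucl n)} {a : ℝ} {f : Eucl n × ℝ → ℝ}
    (h : MemLp f 2 (cylMeasure Ω a)) {A : Eucl n → ℝ} {B : ℝ → ℝ} (hA : Continuous A)
    (hAc : HasCompactSupport A) (hAs : tsupport A ⊆ (Ω : Set (Eucl n))) (hB : Continuous B)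
    (hBc : HasCompactSupport B) (hBs : tsupport B ⊆ Ioi 0) :
    ∫ z in cylinder Ω, f z * (A z.1 * B z.2) =
      ∫ y in Ioi 0, B y * ∫ x, f (x, y) * ratio A x ∂gaussOn Ω := by
  have hi : Integrable (fun z : Eucl n × ℝ => f z * (A z.1 * B z.2)) := by
    have := integrable_test_smul Ω a h (ψ := fun z => A z.1 * B z.2) (by fun_prop)
      (hasCompactSupport_prod_mul hAc hBc)
      (tsupport_prod_mul_subset.trans (prod_mono hAs hBs))
    simpa [mul_comm] using this
  rw [Measure.volume_eq_prod] at hi ⊢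
  have hi' := hi.integrableOn (s := cylinder Ω)
  rw [IntegrableOn, cylinder, ← Measure.prod_restrict] at hi'
  rw [cylinder, ← Measure.prod_restrict, integral_prod_symm _ hi']
  refine integral_congr_ae (Eventually.of_forall fun y => ?_)
  simp only
  rw [← setIntegral_mul_eq_ratio, ← integral_const_mul]
  refine integral_congr_ae (Eventually.of_forall fun x => ?_)
  simp only
  ring

theorem IsTestFunction.exists_Ioo {ψ : ℝ → ℝ} (h : IsTestFunction (Ioi 0) ψ) :
    ∃ R : ℝ, 0 < R ∧ tsupport ψ ⊆ Ioo 0 R := by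
  obtain ⟨M, hM⟩ := h.2.1.bddAbove
  exact ⟨max M 0 + 1, by positivity, fun y hy =>
    ⟨h.2.2 hy, lt_of_le_of_lt ((hM hy).trans (le_max_left M 0)) (lt_add_one _)⟩⟩

theorem IsTestFunction.deriv_one {U : Set ℝ} {ψ : ℝ → ℝ} (h : IsTestFunction U ψ) :
    IsTestFunction U (deriv ψ) :=
  ⟨(contDiff_infty_iff_deriv.1 h.1).2, h.2.1.deriv, tsupport_deriv_subset.trans h.2.2⟩

theorem integrable_test_mul {F ψ : ℝ → ℝ} (hF : ∀ R, IntegrableOn F (Ioc 0 R))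
    (hψ : IsTestFunction (Ioi 0) ψ) : Integrable (fun y => ψ y * F y) := by
  obtain ⟨R, hR, hs⟩ := hψ.exists_Ioo
  obtain ⟨C, hC⟩ := hψ.exists_bound
  refine (integrableOn_iff_integrable_of_support_subset (s := Ioc 0 R) ?_).1
    ((hF R).bdd_mul hψ.1.continuous.aestronglyMeasurable (Eventually.of_forall hC))
  exact fun y hy => Ioo_subset_Ioc_self (hs (subset_tsupport ψ (left_ne_zero_of_mul hy)))

/-- Fubini's theorem on the triangle `t ≤ y ≤ R`, with `R` beyond the support: integrating `ψ'` over
`[t, R]` gives `-ψ(t)`. No regularity of `Q` beyond integrability is used. -/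
theorem integral_deriv_mul_primitive {Q ψ : ℝ → ℝ} (hψ : IsTestFunction (Ioi 0) ψ)
    (hQ : ∀ R, IntegrableOn Q (Ioc 0 R)) :
    ∫ y in Ioi 0, deriv ψ y * ∫ t in Ioc 0 y, Q t = -∫ y in Ioi 0, ψ y * Q y := by
  obtain ⟨R, hR, hs⟩ := hψ.exists_Ioo
  have hzero : ∀ y ∉ Ioc 0 R, ψ y = 0 := fun y hy =>
    image_eq_zero_of_notMem_tsupport fun h => hy (Ioo_subset_Ioc_self (hs h))
  have hzero' : ∀ y ∉ Ioc 0 R, deriv ψ y = 0 := fun y hy =>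
    image_eq_zero_of_notMem_tsupport fun h =>
      hy (Ioo_subset_Ioc_self (hs (tsupport_deriv_subset h)))
  have hψR : ψ R = 0 := image_eq_zero_of_notMem_tsupport fun h => (hs h).2.false
  have hd : Continuous (deriv ψ) := hψ.deriv_one.1.continuous
  have hr : ∀ f : ℝ → ℝ, (∀ y ∉ Ioc 0 R, f y = 0) →
      ∫ y in Ioi 0, f y = ∫ y in Ioc 0 R, f y := fun f hf =>
    setIntegral_eq_of_subset_of_forall_sdiff_eq_zero measurableSet_Ioi Ioc_subset_Ioi_self
      fun y hy => hf y hy.2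
  rw [hr _ fun y hy => by rw [hzero' y hy, zero_mul],
    hr _ fun y hy => by rw [hzero y hy, zero_mul]]
  set S : Set (ℝ × ℝ) := {z | z.2 ≤ z.1} with hS
  have hSm : MeasurableSet S := measurableSet_le measurable_snd measurable_fst
  have hi : Integrable (S.indicator fun z : ℝ × ℝ => deriv ψ z.1 * Q z.2)
      ((volume.restrict (Ioc 0 R)).prod (volume.restrict (Ioc 0 R))) :=
    Integrable.indicator
      (((hd.integrableOn_Icc).mono_set Ioc_subset_Icc_self).mul_prod (hQ R)) hSm
  calc _ = ∫ y in Ioc 0 R, ∫ t in Ioc 0 R,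
        S.indicator (fun z : ℝ × ℝ => deriv ψ z.1 * Q z.2) (y, t) := by
        refine setIntegral_congr_fun measurableSet_Ioc fun y hy => ?_
        rw [← integral_const_mul, ← inter_eq_self_of_subset_right (Ioc_subset_Ioc_right hy.2),
          ← setIntegral_indicator measurableSet_Ioc]
        refine setIntegral_congr_fun measurableSet_Ioc fun t ht => ?_
        simp [indicator, hS, ht.1]
    _ = ∫ t in Ioc 0 R, ∫ y in Ioc 0 R,
        S.indicator (fun z : ℝ × ℝ => deriv ψ z.1 * Q z.2) (y, t) := integral_integral_swap hi
    _ = ∫ t in Ioc 0 R, -(ψ t * Q t) := by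
        refine setIntegral_congr_fun measurableSet_Ioc fun t ht => ?_
        have h1 : ∫ y in Ioc 0 R, S.indicator (fun z : ℝ × ℝ => deriv ψ z.1 * Q z.2) (y, t) =
            ∫ y in Ioc 0 R, (Ici t).indicator (fun y => deriv ψ y * Q t) y := by
          refine setIntegral_congr_fun measurableSet_Ioc fun y _ => ?_
          simp [indicator, hS]
        have h2 : Ioc 0 R ∩ Ici t = Icc t R := by
          ext y
          simp only [mem_inter_iff, mem_Ioc, mem_Ici, mem_Icc]
          exact ⟨fun h => ⟨h.2, h.1.2⟩, fun h => ⟨⟨ht.1.trans_le h.1, h.2⟩, h.1⟩⟩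
        rw [h1, setIntegral_indicator measurableSet_Ici, h2, integral_mul_const,
          integral_Icc_eq_integral_Ioc, ← intervalIntegral.integral_of_le ht.2,
          intervalIntegral.integral_deriv_eq_sub (fun y _ => hψ.differentiable y)
            (hd.intervalIntegrable _ _), hψR]
        ring
    _ = _ := integral_neg _

/-- The primitive from `0` vanishes below the support of `χ`, and the zero mean makes it vanish
above, so it has compact support in `(0, ∞)`. -/
theorem IsTestFunction.exists_primitive {χ : ℝ → ℝ} (h : IsTestFunction (Ioi 0) χ)
    (h0 : ∫ y, χ y = 0) : ∃ Ψ, IsTestFunction (Ioi 0) Ψ ∧ deriv Ψ = χ := by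
  have hc := h.1.continuous
  have hder : ∀ y, HasDerivAt (fun y => ∫ t in (0 : ℝ)..y, χ t) (χ y) y := fun y =>
    hc.integral_hasStrictDerivAt 0 y |>.hasDerivAt
  have hd : deriv (fun y => ∫ t in (0 : ℝ)..y, χ t) = χ := funext fun y => (hder y).deriv
  obtain ⟨R, hR, hs⟩ := h.exists_Ioo
  -- The support, being compact in the open half-line, stays at a positive distance from `0`; the
  -- value `1` only covers `χ = 0`.
  obtain ⟨δ, hδ, hs'⟩ : ∃ δ : ℝ, 0 < δ ∧ tsupport χ ⊆ Icc δ R := by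
    rcases (tsupport χ).eq_empty_or_nonempty with he | hne
    · exact ⟨1, one_pos, by simp [he]⟩
    · obtain ⟨m, hm, hmin⟩ := h.2.1.exists_isLeast hne
      exact ⟨m, h.2.2 hm, fun y hy => ⟨hmin hy, (hs hy).2.le⟩⟩
  have hz : ∀ y ∉ Icc δ R, χ y = 0 := fun y hy =>
    image_eq_zero_of_notMem_tsupport fun h' => hy (hs' h')
  have hsupp : tsupport (fun y => ∫ t in (0 : ℝ)..y, χ t) ⊆ Icc δ R := by
    refine closure_minimal (fun y hy => ?_) isClosed_Icc
    by_contra hyn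
    refine hy ?_
    simp only
    rcases lt_or_ge y δ with h1 | h1
    · rw [intervalIntegral.integral_congr (g := fun _ => 0), intervalIntegral.integral_zero]
      intro t ht
      refine hz t fun h2 => ?_
      have := (uIcc_subset_Icc (a₂ := min 0 y) (b₂ := max 0 y)
        ⟨min_le_left _ _, le_max_left _ _⟩ ⟨min_le_right _ _, le_max_right _ _⟩ ht).2
      rcases max_cases 0 y with h3 | h3 <;> linarith [h2.1]
    · have hyR : R < y := by
        by_contra h2
        exact hyn ⟨h1, not_lt.1 h2⟩
      rw [intervalIntegral.integral_of_le (hR.trans hyR).le,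
        setIntegral_eq_integral_of_forall_compl_eq_zero, h0]
      intro t ht
      refine hz t fun h2 => ht ⟨hδ.trans_le h2.1, h2.2.trans hyR.le⟩
  refine ⟨_, ⟨contDiff_infty_iff_deriv.2 ⟨fun y => (hder y).differentiableAt, ?_⟩,
    isCompact_Icc.of_isClosed_subset (isClosed_tsupport _) hsupp,
    hsupp.trans fun y hy => hδ.trans_le hy.1⟩, hd⟩
  rw [hd]
  exact h.1

theorem exists_test_integral_one : ∃ η : ℝ → ℝ, IsTestFunction (Ioi 0) η ∧ ∫ y, η y = 1 := by
  let f : ContDiffBump (2 : ℝ) := ⟨1 / 2, 1, by norm_num, by norm_num⟩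
  refine ⟨f.normed volume, ⟨f.contDiff_normed, f.hasCompactSupport_normed, ?_⟩,
    f.integral_normed⟩
  rw [f.tsupport_normed_eq, Real.closedBall_eq_Icc]
  intro y hy
  have : (2 : ℝ) - 1 ≤ y := hy.1
  exact lt_of_lt_of_le (by norm_num) this

theorem ae_eq_zero_of_test {W : ℝ → ℝ} (hW : ∀ R, IntegrableOn W (Ioc 0 R))
    (h : ∀ ψ, IsTestFunction (Ioi 0) ψ → ∫ y in Ioi 0, ψ y * W y = 0) :
    ∀ᵐ y ∂(volume.restrict (Ioi (0 : ℝ))), W y = 0 := by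
  have hloc : LocallyIntegrableOn W (Ioi 0) := by
    refine (locallyIntegrableOn_iff isOpen_Ioi.isLocallyClosed).2 fun K hK hKc => ?_
    obtain ⟨M, hM⟩ := hKc.bddAbove
    exact (hW M).mono_set fun y hy => ⟨hK hy, hM hy⟩
  rw [ae_restrict_iff' measurableSet_Ioi]
  refine isOpen_Ioi.ae_eq_zero_of_integral_contDiff_smul_eq_zero hloc fun g g1 g2 g3 => ?_
  rw [← h g ⟨g1, g2, g3⟩, setIntegral_eq_integral_of_forall_compl_eq_zero]
  · rfl
  · intro y hy
    rw [image_eq_zero_of_notMem_tsupport fun h' => hy (g3 h'), zero_mul]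

/-- The du Bois-Reymond argument: with `∫ η = 1`, the function `ψ - (∫ ψ) η` has zero mean and is
therefore the derivative of a test function. Testing `W` with it gives `∫ ψ (W - c) = 0`, where `c =
∫ η W`. -/
theorem ae_eq_const_of_weak_deriv_zero {W : ℝ → ℝ} (hW : ∀ R, IntegrableOn W (Ioc 0 R))
    (h : ∀ ψ, IsTestFunction (Ioi 0) ψ → ∫ y in Ioi 0, deriv ψ y * W y = 0) :
    ∃ c, ∀ᵐ y ∂(volume.restrict (Ioi (0 : ℝ))), W y = c := by
  obtain ⟨η, hη, h1⟩ := exists_test_integral_one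
  refine ⟨∫ y in Ioi 0, η y * W y, ?_⟩
  set c := ∫ y in Ioi 0, η y * W y with hc
  have hconst : ∀ R, IntegrableOn (fun _ : ℝ => c) (Ioc 0 R) := fun R => by simp
  have key := ae_eq_zero_of_test (W := fun y => W y - c)
    (fun R => (hW R).sub (hconst R)) fun ψ hψ => by
      have hiψ : Integrable ψ := hψ.1.continuous.integrable_of_hasCompactSupport hψ.2.1
      have hiη : Integrable η := hη.1.continuous.integrable_of_hasCompactSupport hη.2.1
      obtain ⟨Ψ, hΨ, hd⟩ := IsTestFunction.exists_primitive
        (hψ.add (hη.smul (-∫ y, ψ y))) (by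
          simp only [Pi.add_apply, Pi.smul_apply, smul_eq_mul]
          rw [integral_add hiψ (hiη.const_mul _), integral_const_mul, h1]
          ring)
      have h2 := h Ψ hΨ
      rw [hd] at h2
      simp only [Pi.add_apply, Pi.smul_apply, smul_eq_mul, add_mul, mul_assoc] at h2
      rw [integral_add (integrable_test_mul hW hψ).integrableOn
        ((integrable_test_mul hW hη).const_mul _).integrableOn, integral_const_mul, ← hc] at h2
      simp only [mul_sub]
      rw [integral_sub (integrable_test_mul hW hψ).integrableOn
        (hiψ.mul_const c).integrableOn, integral_mul_const,
        setIntegral_eq_integral_of_forall_compl_eq_zero (f := ψ) fun y hy =>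
          image_eq_zero_of_notMem_tsupport fun h' => hy (hψ.2.2 h')]
      linarith
  filter_upwards [key] with y hy
  exact sub_eq_zero.1 hy

theorem ae_eq_primitive_of_weak_deriv {F Q : ℝ → ℝ} (hF : ∀ R, IntegrableOn F (Ioc 0 R))
    (hQ : ∀ R, IntegrableOn Q (Ioc 0 R))
    (h : ∀ ψ, IsTestFunction (Ioi 0) ψ →
      ∫ y in Ioi 0, deriv ψ y * F y = -∫ y in Ioi 0, ψ y * Q y) :
    ∃ c, ∀ᵐ y ∂(volume.restrict (Ioi (0 : ℝ))), F y - ∫ t in Ioc 0 y, Q t = c := by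
  have hP : ∀ R, IntegrableOn (fun y => ∫ t in Ioc 0 y, Q t) (Ioc 0 R) := by
    intro R
    rcases lt_or_ge R 0 with hR | hR
    · simp [Ioc_eq_empty (not_lt.2 hR.le)]
    have hc := intervalIntegral.continuousOn_primitive (a := (0 : ℝ)) (b := R) (f := Q)
      (μ := volume) ((integrableOn_Icc_iff_integrableOn_Ioc).2 (hQ R))
    exact (hc.integrableOn_Icc).mono_set Ioc_subset_Icc_self
  refine ae_eq_const_of_weak_deriv_zero (fun R => (hF R).sub (hP R)) fun ψ hψ => ?_
  simp only [mul_sub]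
  rw [integral_sub (integrable_test_mul hF hψ.deriv_one).integrableOn
    (integrable_test_mul hP hψ.deriv_one).integrableOn, h ψ hψ,
    integral_deriv_mul_primitive hψ hQ, sub_self]

/-! ### Slices of the weak gradient and existence of the trace -/

section slices

variable {n : ℕ} {Ω : Opens (Eucl n)} {a : ℝ}

/-- The horizontal part `∇ₓ v` of a gradient. -/
def horiz (G : Eucl n × ℝ → EuclProd n) (z : Eucl n × ℝ) : Eucl n := (G z).fst

/-- The vertical part `∂_y v` of a gradient. -/
def vert (G : Eucl n × ℝ → EuclProd n) (z : Eucl n × ℝ) : ℝ := (G z).snd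

theorem stronglyMeasurable_horiz {G : Eucl n × ℝ → EuclProd n} (hG : StronglyMeasurable G) :
    StronglyMeasurable (horiz G) :=
  (WithLp.prod_continuous_ofLp 2 (Eucl n) ℝ).fst.comp_stronglyMeasurable hG

theorem stronglyMeasurable_vert {G : Eucl n × ℝ → EuclProd n} (hG : StronglyMeasurable G) :
    StronglyMeasurable (vert G) :=
  (WithLp.prod_continuous_ofLp 2 (Eucl n) ℝ).snd.comp_stronglyMeasurable hG

theorem norm_fst_le (w : EuclProd n) : ‖w.fst‖ ≤ ‖w‖ := by
  refine le_of_sq_le_sq ?_ (norm_nonneg _)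
  rw [WithLp.prod_norm_sq_eq_of_L2]
  nlinarith [sq_nonneg ‖w.snd‖]

theorem norm_snd_le (w : EuclProd n) : ‖w.snd‖ ≤ ‖w‖ := by
  refine le_of_sq_le_sq ?_ (norm_nonneg _)
  rw [WithLp.prod_norm_sq_eq_of_L2]
  nlinarith [sq_nonneg ‖w.fst‖]

theorem eLpNorm_horiz_le (G : Eucl n × ℝ → EuclProd n) (μ : Measure (Eucl n × ℝ)) :
    eLpNorm (horiz G) 2 μ ≤ eLpNorm G 2 μ :=
  eLpNorm_mono fun z => norm_fst_le (G z)

theorem eLpNorm_vert_le (G : Eucl n × ℝ → EuclProd n) (μ : Measure (Eucl n × ℝ)) :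
    eLpNorm (vert G) 2 μ ≤ eLpNorm G 2 μ :=
  eLpNorm_mono fun z => norm_snd_le (G z)

theorem memLp_horiz {G : Eucl n × ℝ → EuclProd n} (hG : StronglyMeasurable G)
    (h : MemLp G 2 (cylMeasure Ω a)) : MemLp (horiz G) 2 (cylMeasure Ω a) :=
  ⟨(stronglyMeasurable_horiz hG).aestronglyMeasurable, (eLpNorm_horiz_le G _).trans_lt h.2⟩

theorem memLp_vert {G : Eucl n × ℝ → EuclProd n} (hG : StronglyMeasurable G)
    (h : MemLp G 2 (cylMeasure Ω a)) : MemLp (vert G) 2 (cylMeasure Ω a) :=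
  ⟨(stronglyMeasurable_vert hG).aestronglyMeasurable, (eLpNorm_vert_le G _).trans_lt h.2⟩

theorem fderiv_prod_mul {φ : Eucl n → ℝ} {ψ : ℝ → ℝ} (hφ : Differentiable ℝ φ)
    (hψ : Differentiable ℝ ψ) (z : Eucl n × ℝ) (e : Eucl n) (τ : ℝ) :
    fderiv ℝ (fun z : Eucl n × ℝ => φ z.1 * ψ z.2) z (e, τ) =
      fderiv ℝ φ z.1 e * ψ z.2 + φ z.1 * (deriv ψ z.2 * τ) := by
  have h1 := (hφ z.1).hasFDerivAt.comp z hasFDerivAt_fst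
  have h2 := (hψ z.2).hasFDerivAt.comp z hasFDerivAt_snd
  have h3 : HasFDerivAt (fun z : Eucl n × ℝ => φ z.1 * ψ z.2) _ z := h1.mul h2
  rw [h3.fderiv]
  have : fderiv ℝ ψ z.2 τ = deriv ψ z.2 * τ := by
    rw [← fderiv_apply_one_eq_deriv]
    conv_lhs => rw [← mul_one τ, ← smul_eq_mul, map_smul, smul_eq_mul]
    ring
  simp [this]
  ring

theorem HasWeakGradient.horizontal {V : Eucl n × ℝ → ℝ} {G : Eucl n × ℝ → EuclProd n}
    (h : HasWeakGradient Ω V G) (hV : MemLp V 2 (cylMeasure Ω a)) (hGm : StronglyMeasurable G)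
    (hG : MemLp G 2 (cylMeasure Ω a)) {φ : Eucl n → ℝ}
    (hφ : IsTestFunction (Ω : Set (Eucl n)) φ) {ψ : ℝ → ℝ} (hψ : IsTestFunction (Ioi 0) ψ)
    (e : Eucl n) :
    ∫ y in Ioi 0, ψ y * ∫ x, V (x, y) * ratio (fun x => fderiv ℝ φ x e) x ∂gaussOn Ω =
      -∫ y in Ioi 0, ψ y * ∫ x, inner ℝ (horiz G (x, y)) e * ratio φ x ∂gaussOn Ω := by
  have h1 := h _ (hφ.prod_mul hψ) (WithLp.toLp 2 (e, 0))
  simp only [fderiv_prod_mul hφ.differentiable hψ.differentiable, mul_zero, add_zero,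
    WithLp.prod_inner_apply, inner_zero_right] at h1
  have hd := hφ.fderiv_apply' e
  have hi : MemLp (fun z => inner ℝ (horiz G z) e) 2 (cylMeasure Ω a) := by
    simpa only [real_inner_comm] using (memLp_horiz hGm hG).const_inner (𝕜 := ℝ) e
  rw [integral_cylinder_prod_mul hV hd.1.continuous hd.2.1 hd.2.2 hψ.1.continuous hψ.2.1 hψ.2.2]
    at h1
  rw [h1]
  congr 1
  exact integral_cylinder_prod_mul hi hφ.1.continuous hφ.2.1 hφ.2.2 hψ.1.continuous hψ.2.1
    hψ.2.2

theorem HasWeakGradient.vertical {V : Eucl n × ℝ → ℝ} {G : Eucl n × ℝ → EuclProd n}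
    (h : HasWeakGradient Ω V G) (hV : MemLp V 2 (cylMeasure Ω a)) (hGm : StronglyMeasurable G)
    (hG : MemLp G 2 (cylMeasure Ω a)) {φ : Eucl n → ℝ}
    (hφ : IsTestFunction (Ω : Set (Eucl n)) φ) {ψ : ℝ → ℝ} (hψ : IsTestFunction (Ioi 0) ψ) :
    ∫ y in Ioi 0, deriv ψ y * ∫ x, V (x, y) * ratio φ x ∂gaussOn Ω =
      -∫ y in Ioi 0, ψ y * ∫ x, vert G (x, y) * ratio φ x ∂gaussOn Ω := by
  have h1 := h _ (hφ.prod_mul hψ) (WithLp.toLp 2 (0, 1))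
  have hinner : ∀ r : ℝ, inner ℝ r 1 = r := fun r => by simp
  simp only [fderiv_prod_mul hφ.differentiable hψ.differentiable, map_zero, zero_mul, zero_add,
    mul_one, WithLp.prod_inner_apply, inner_zero_right, hinner] at h1
  have hd := hψ.deriv_one
  rw [integral_cylinder_prod_mul hV hφ.1.continuous hφ.2.1 hφ.2.2 hd.1.continuous hd.2.1 hd.2.2]
    at h1
  rw [h1]
  congr 1
  exact integral_cylinder_prod_mul (memLp_vert hGm hG) hφ.1.continuous hφ.2.1 hφ.2.2
    hψ.1.continuous hψ.2.1 hψ.2.2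

theorem HasWeakGradient.ae_slice_eq (ha : a < 1) {V : Eucl n × ℝ → ℝ}
    {G : Eucl n × ℝ → EuclProd n} (h : HasWeakGradient Ω V G) (hVm : StronglyMeasurable V)
    (hV : MemLp V 2 (cylMeasure Ω a)) (hGm : StronglyMeasurable G)
    (hG : MemLp G 2 (cylMeasure Ω a)) {φ : Eucl n → ℝ}
    (hφ : IsTestFunction (Ω : Set (Eucl n)) φ) (e : Eucl n) :
    ∀ᵐ y ∂(volume.restrict (Ioi (0 : ℝ))),
      ∫ x, V (x, y) * ratio (fun x => fderiv ℝ φ x e) x ∂gaussOn Ω =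
        -∫ x, inner ℝ (horiz G (x, y)) e * ratio φ x ∂gaussOn Ω := by
  have hd := hφ.fderiv_apply' e
  have hi : MemLp (fun z => inner ℝ (horiz G z) e) 2 (cylMeasure Ω a) := by
    simpa only [real_inner_comm] using (memLp_horiz hGm hG).const_inner (𝕜 := ℝ) e
  have i1 := integrableOn_slab ha hVm hV (continuous_ratio hd.1.continuous).stronglyMeasurable
    (memLp_ratio Ω hd.1.continuous hd.2.1)
  have i2 := integrableOn_slab ha ((stronglyMeasurable_horiz hGm).inner stronglyMeasurable_const)
    hi (continuous_ratio hφ.1.continuous).stronglyMeasurable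
    (memLp_ratio Ω hφ.1.continuous hφ.2.1)
  have key := ae_eq_zero_of_test (fun R => (i1 R).add (i2 R)) fun ψ hψ => by
    simp only [Pi.add_apply, mul_add]
    rw [integral_add (integrable_test_mul i1 hψ).integrableOn
      (integrable_test_mul i2 hψ).integrableOn, h.horizontal hV hGm hG hφ hψ e, neg_add_cancel]
  filter_upwards [key] with y hy
  exact eq_neg_of_add_eq_zero_left hy

/-- The lateral condition supplies, for each slice, some gradient with no a priori relation to `∇v`.
Both it and `∇ₓ v(·,y)` satisfy the same integration by parts against countably many test functions
and coordinate directions, hence they agree for almost every `y`, and the `H¹₀` estimates hold with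
`∇ₓ v(·,y)`. -/
theorem HasWeakGradient.ae_slice_memH10 (ha : a < 1) {V : Eucl n × ℝ → ℝ}
    {G : Eucl n × ℝ → EuclProd n} (h : HasWeakGradient Ω V G) (hVm : StronglyMeasurable V)
    (hV : MemLp V 2 (cylMeasure Ω a)) (hGm : StronglyMeasurable G)
    (hG : MemLp G 2 (cylMeasure Ω a))
    (hlat : ∀ᵐ y ∂(volume.restrict (Ioi (0 : ℝ))), MemH10 Ω fun x => V (x, y)) :
    ∀ᵐ y ∂(volume.restrict (Ioi (0 : ℝ))), ∃ (u : L2Gauss Ω) (g : Lp (Eucl n) 2 (gaussOn Ω)),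
      (u =ᵐ[gaussOn Ω] fun x => V (x, y)) ∧ (g =ᵐ[gaussOn Ω] fun x => horiz G (x, y)) ∧
      (1 - (gauss n).real (Ω : Set (Eucl n))) * ‖u‖ ^ 2 ≤ (Real.pi / 2) ^ 2 * ‖g‖ ^ 2 ∧
      ∀ θ, 0 ≤ θ → ∀ T, IsMehler Ω θ T → ‖u - T u‖ ≤ θ * ‖g‖ := by
  obtain ⟨φ, hφ, hdet⟩ := exists_determining_seq Ω
  have hall : ∀ᵐ y ∂(volume.restrict (Ioi (0 : ℝ))), ∀ k (i : Fin n),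
      ∫ x, V (x, y) * ratio (fun x => fderiv ℝ (φ k) x (EuclideanSpace.single i 1)) x ∂gaussOn Ω =
        -∫ x, inner ℝ (horiz G (x, y)) (EuclideanSpace.single i 1) * ratio (φ k) x ∂gaussOn Ω :=
    ae_all_iff.2 fun k => ae_all_iff.2 fun i => h.ae_slice_eq ha hVm hV hGm hG (hφ k) _
  filter_upwards [hall, hlat, memLp_slice (stronglyMeasurable_horiz hGm) (memLp_horiz hGm hG)]
    with y hy hH hq
  set u : L2Gauss Ω := hH.1.toLp _ with hu
  have hue : u =ᵐ[gaussOn Ω] fun x => V (x, y) := hH.1.coeFn_toLp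
  obtain ⟨g, hg, hrest⟩ := MemH10.exists_gradient (hH.congr hue.symm)
  refine ⟨u, g, hue, ?_, hrest⟩
  have hinner : ∀ {f : Eucl n → Eucl n} (e : Eucl n), MemLp f 2 (gaussOn Ω) →
      MemLp (fun x => inner ℝ (f x) e) 2 (gaussOn Ω) := fun e hf => by
    simpa only [real_inner_comm] using hf.const_inner (𝕜 := ℝ) e
  have hcoord : ∀ i : Fin n, (fun x => inner ℝ (g x) (EuclideanSpace.single i 1) -
      inner ℝ (horiz G (x, y)) (EuclideanSpace.single i (1 : ℝ))) =ᵐ[gaussOn Ω] 0 := by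
    intro i
    refine hdet _ ((hinner _ (Lp.memLp g)).sub (hinner _ hq)) fun k => ?_
    have e1 := hg (φ k) (hφ k) (EuclideanSpace.single i 1)
    have e2 := hy k i
    have e3 : ∫ x, u x * ratio (fun x => fderiv ℝ (φ k) x (EuclideanSpace.single i 1)) x
        ∂gaussOn Ω = ∫ x, V (x, y) *
          ratio (fun x => fderiv ℝ (φ k) x (EuclideanSpace.single i 1)) x ∂gaussOn Ω := by
      refine integral_congr_ae ?_
      filter_upwards [hue] with x hx
      rw [hx]
    have hr := memLp_ratio Ω (hφ k).1.continuous (hφ k).2.1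
    simp only [sub_mul]
    rw [integral_sub]
    · linarith
    · exact (hinner _ (Lp.memLp g)).integrable_mul hr
    · exact (hinner _ hq).integrable_mul hr
  filter_upwards [ae_all_iff.2 hcoord] with x hx
  ext i
  have := hx i
  simp only [EuclideanSpace.inner_single_right] at this
  simpa [sub_eq_zero] using this

/-- Paired with any determining test function, `V(·,y) - ∫₀^y ∂_y V dt` has zero weak derivative in
`y`, so it is almost everywhere constant. Countably many pairings fix the function itself, so it is
the same for almost every `y`; the distance to it is the norm of the primitive. -/
theorem HasWeakGradient.exists_trace (ha : a < 1) {V : Eucl n × ℝ → ℝ}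
    {G : Eucl n × ℝ → EuclProd n} (h : HasWeakGradient Ω V G) (hVm : StronglyMeasurable V)
    (hV : MemLp V 2 (cylMeasure Ω a)) (hGm : StronglyMeasurable G)
    (hG : MemLp G 2 (cylMeasure Ω a)) :
    ∃ t : L2Gauss Ω, ∀ᵐ y ∂(volume.restrict (Ioi (0 : ℝ))),
      eLpNorm (fun x => V (x, y) - t x) 2 (gaussOn Ω) ^ 2 ≤
        ENNReal.ofReal (y ^ (1 - a) / (1 - a)) * eLpNorm G 2 (cylMeasure Ω a) ^ 2 := by
  obtain ⟨φ, hφ, hdet⟩ := exists_determining_seq Ω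
  have hpm := stronglyMeasurable_vert hGm
  have hp := memLp_vert hGm hG
  have hrm : ∀ k, StronglyMeasurable (ratio (φ k)) := fun k =>
    (continuous_ratio (hφ k).1.continuous).stronglyMeasurable
  have hr : ∀ k, MemLp (ratio (φ k)) 2 (gaussOn Ω) := fun k =>
    memLp_ratio Ω (hφ k).1.continuous (hφ k).2.1
  have hconst : ∀ k, ∃ c, ∀ᵐ y ∂(volume.restrict (Ioi (0 : ℝ))),
      ∫ x, V (x, y) * ratio (φ k) x ∂gaussOn Ω -
        ∫ x, vertPrim (vert G) y x * ratio (φ k) x ∂gaussOn Ω = c := by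
    intro k
    simp_rw [integral_vertPrim_mul ha hpm hp (hrm k) (hr k)]
    exact ae_eq_primitive_of_weak_deriv (integrableOn_slab ha hVm hV (hrm k) (hr k))
      (integrableOn_slab ha hpm hp (hrm k) (hr k))
      fun ψ hψ => h.vertical hV hGm hG (hφ k) hψ
  choose c hc using hconst
  have hprim : ∀ y, 0 ≤ y → eLpNorm (vertPrim (vert G) y) 2 (gaussOn Ω) ^ 2 ≤
      ENNReal.ofReal (y ^ (1 - a) / (1 - a)) * eLpNorm G 2 (cylMeasure Ω a) ^ 2 := fun y hy =>
    (eLpNorm_vertPrim_le ha hpm hy).trans (by gcongr; exact eLpNorm_vert_le G _)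
  have hprimLp : ∀ y, 0 ≤ y → MemLp (vertPrim (vert G) y) 2 (gaussOn Ω) := fun y hy =>
    ⟨(stronglyMeasurable_vertPrim hpm y).aestronglyMeasurable,
      (ENNReal.pow_lt_top_iff.1 ((hprim y hy).trans_lt (ENNReal.mul_lt_top ENNReal.ofReal_lt_top
        (ENNReal.pow_lt_top hG.2)))).resolve_right (by norm_num)⟩
  have hgood : ∀ᵐ y ∂(volume.restrict (Ioi (0 : ℝ))), 0 < y ∧
      MemLp (fun x => V (x, y)) 2 (gaussOn Ω) ∧ ∀ k,
      ∫ x, V (x, y) * ratio (φ k) x ∂gaussOn Ω -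
        ∫ x, vertPrim (vert G) y x * ratio (φ k) x ∂gaussOn Ω = c k := by
    filter_upwards [ae_all_iff.2 hc, memLp_slice hVm hV, ae_restrict_mem measurableSet_Ioi]
      with y h1 h2 h3
    exact ⟨h3, h2, h1⟩
  have hne : (ae (volume.restrict (Ioi (0 : ℝ)))).NeBot := by
    rw [ae_neBot, Ne, Measure.restrict_eq_zero]
    simp
  -- Any good height `y₀` defines the trace as `V(·,y₀)` minus the primitive up to `y₀`.
  obtain ⟨y₀, hy₀, hV₀, hc₀⟩ := hgood.exists
  have ht := hV₀.sub (hprimLp y₀ hy₀.le)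
  refine ⟨ht.toLp _, ?_⟩
  filter_upwards [hgood] with y hy
  obtain ⟨hy0, hVy, hcy⟩ := hy
  refine le_trans (le_of_eq ?_) (hprim y hy0.le)
  congr 1
  refine eLpNorm_congr_ae ?_
  have hty := hVy.sub (hprimLp y hy0.le)
  have hz := hdet _ (hty.sub ht) fun k => by
    have e1 := hc₀ k
    have e2 := hcy k
    simp only [Pi.sub_apply, sub_mul]
    rw [integral_sub, integral_sub, integral_sub]
    · linarith
    · exact hV₀.integrable_mul (hr k)
    · exact (hprimLp y₀ hy₀.le).integrable_mul (hr k)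
    · exact hVy.integrable_mul (hr k)
    · exact (hprimLp y hy0.le).integrable_mul (hr k)
    · exact (hVy.integrable_mul (hr k)).sub ((hprimLp y hy0.le).integrable_mul (hr k))
    · exact (hV₀.integrable_mul (hr k)).sub ((hprimLp y₀ hy₀.le).integrable_mul (hr k))
  filter_upwards [hz, ht.coeFn_toLp] with x e1 e2
  simp only [Pi.sub_apply, Pi.zero_apply] at e1 e2
  rw [e2]
  linarith

end slices

/-! ### Uniqueness and linearity of traces -/

/-- An interval `(0, ε)` is not a null set. Without this, limits along the filter in `IsTrace` would
not be unique. -/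
theorem neBot_nhdsWithin_inf_ae : (𝓝[>] (0 : ℝ) ⊓ ae volume).NeBot := by
  rw [inf_neBot_iff]
  intro U hU N hN
  obtain ⟨ε, hε, hU⟩ := mem_nhdsGT_iff_exists_Ioo_subset.1 hU
  by_contra hne
  have hsub : Ioo 0 ε ⊆ Nᶜ := fun y hy hyN => hne ⟨y, hU hy, hyN⟩
  have h0 := measure_mono_null hsub (mem_ae_iff.1 hN)
  rw [Real.volume_Ioo, ENNReal.ofReal_eq_zero] at h0
  have : 0 < ε := hε
  linarith

theorem eventually_nhdsWithin_inf_ae {p : ℝ → Prop}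
    (h : ∀ᵐ y ∂(volume.restrict (Ioi (0 : ℝ))), p y) :
    ∀ᶠ y in 𝓝[>] (0 : ℝ) ⊓ ae volume, 0 < y ∧ p y := by
  rw [ae_restrict_iff' measurableSet_Ioi] at h
  filter_upwards [h.filter_mono inf_le_right,
    Eventually.filter_mono inf_le_left self_mem_nhdsWithin] with y h1 h2
  exact ⟨h2, h1 h2⟩

section trace

variable {n : ℕ} {Ω : Opens (Eucl n)} {a : ℝ}

theorem IsTrace.unique {V : Eucl n × ℝ → ℝ} (hV : StronglyMeasurable V) {u w : L2Gauss Ω}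
    (hu : IsTrace V u) (hw : IsTrace V w) : u = w := by
  have := neBot_nhdsWithin_inf_ae
  have h1 : Tendsto (fun _ : ℝ => eLpNorm (fun x => u x - w x) 2 (gaussOn Ω))
      (𝓝[>] (0 : ℝ) ⊓ ae volume) (𝓝 0) := by
    refine tendsto_of_tendsto_of_tendsto_of_le_of_le tendsto_const_nhds
      (by simpa using Tendsto.add hu hw) (fun _ => zero_le) fun y => ?_
    have hVy : AEStronglyMeasurable (fun x => V (x, y)) (gaussOn Ω) :=
      (hV.comp_measurable measurable_prodMk_right).aestronglyMeasurable
    have h2 := eLpNorm_sub_le (μ := gaussOn Ω) (p := 2) (f := fun x => V (x, y) - w x)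
      (g := fun x => V (x, y) - u x) (hVy.sub (Lp.memLp w).1) (hVy.sub (Lp.memLp u).1)
      (by norm_num)
    rw [add_comm]
    refine le_trans (le_of_eq ?_) h2
    congr 1
    ext x
    simp
  have h3 := tendsto_nhds_unique tendsto_const_nhds h1
  rw [eLpNorm_eq_zero_iff (f := fun x => u x - w x) ((Lp.memLp u).1.sub (Lp.memLp w).1)
    (by norm_num)] at h3
  refine Lp.ext ?_
  filter_upwards [h3] with x hx
  exact sub_eq_zero.1 hx

theorem IsTrace.congr {V W : Eucl n × ℝ → ℝ} {u : L2Gauss Ω} (h : IsTrace V u)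
    (hVW : V =ᵐ[cylMeasure Ω a] W) : IsTrace W u := by
  refine Tendsto.congr' ?_ h
  filter_upwards [eventually_nhdsWithin_inf_ae (ae_powMeasure_iff.1 (ae_slice hVW))] with y hy
  refine eLpNorm_congr_ae ?_
  filter_upwards [hy.2] with x hx
  rw [hx]

theorem IsTrace.add {V W : Eucl n × ℝ → ℝ} (hV : StronglyMeasurable V)
    (hW : StronglyMeasurable W) {u w : L2Gauss Ω}
    (hu : IsTrace V u) (hw : IsTrace W w) : IsTrace (V + W) (u + w) := by
  refine tendsto_of_tendsto_of_tendsto_of_le_of_le tendsto_const_nhds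
    (by simpa using Tendsto.add hu hw) (fun _ => zero_le) fun y => ?_
  have hs : ∀ {F : Eucl n × ℝ → ℝ}, StronglyMeasurable F →
      AEStronglyMeasurable (fun x => F (x, y)) (gaussOn Ω) := fun hF =>
    (hF.comp_measurable measurable_prodMk_right).aestronglyMeasurable
  have h2 := eLpNorm_add_le (μ := gaussOn Ω) (p := 2) (f := fun x => V (x, y) - u x)
    (g := fun x => W (x, y) - w x) ((hs hV).sub (Lp.memLp u).1) ((hs hW).sub (Lp.memLp w).1)
    (by norm_num)
  refine le_trans (le_of_eq (eLpNorm_congr_ae ?_)) h2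
  filter_upwards [Lp.coeFn_add u w] with x hx
  simp only [hx, Pi.add_apply]
  ring

theorem IsTrace.smul {V : Eucl n × ℝ → ℝ} {u : L2Gauss Ω} (c : ℝ) (hu : IsTrace V u) :
    IsTrace (c • V) (c • u) := by
  have h1 := ENNReal.Tendsto.const_mul hu (Or.inr (by simp : (‖c‖ₑ : ℝ≥0∞) ≠ ⊤))
  rw [mul_zero] at h1
  refine h1.congr fun y => ?_
  rw [← eLpNorm_const_smul]
  refine eLpNorm_congr_ae ?_
  filter_upwards [Lp.coeFn_smul c u] with x hx
  simp only [hx, Pi.smul_apply, smul_eq_mul]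
  ring

/-! ### The trace operator: continuity and compactness -/

namespace EnergySpace

theorem exists_trace (ha : a < 1) (v : EnergySpace Ω a) :
    ∃ t : L2Gauss Ω, ∀ᵐ y ∂(volume.restrict (Ioi (0 : ℝ))),
      eLpNorm (fun x => toL2 v (x, y) - t x) 2 (gaussOn Ω) ≤
        ENNReal.ofReal (√(y ^ (1 - a) / (1 - a)) * ‖v‖) := by
  obtain ⟨t, ht⟩ := (hasWeakGradient v).exists_trace ha (Lp.stronglyMeasurable _)
    (Lp.memLp (toL2 v)) (Lp.stronglyMeasurable _) (Lp.memLp (grad v))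
  refine ⟨t, ?_⟩
  filter_upwards [ht, ae_restrict_mem measurableSet_Ioi] with y hy hy0
  refine (ENNReal.pow_le_pow_left_iff (n := 2) (by norm_num)).1 (hy.trans (le_of_eq ?_))
  have h1 : 0 ≤ y ^ (1 - a) / (1 - a) :=
    div_nonneg (Real.rpow_nonneg (le_of_lt hy0) _) (by linarith)
  rw [← Lp.enorm_def, ENNReal.ofReal_mul (Real.sqrt_nonneg _), mul_pow,
    ← ENNReal.ofReal_pow (Real.sqrt_nonneg _), Real.sq_sqrt h1, norm_eq, ofReal_norm]

/-- The trace at `y = 0` of an element of the energy space. -/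
def trace (ha : a < 1) (v : EnergySpace Ω a) : L2Gauss Ω := (exists_trace ha v).choose

theorem trace_spec (ha : a < 1) (v : EnergySpace Ω a) :
    ∀ᵐ y ∂(volume.restrict (Ioi (0 : ℝ))),
      eLpNorm (fun x => toL2 v (x, y) - trace ha v x) 2 (gaussOn Ω) ≤
        ENNReal.ofReal (√(y ^ (1 - a) / (1 - a)) * ‖v‖) :=
  (exists_trace ha v).choose_spec

theorem tendsto_sqrt_rpow (ha : a < 1) :
    Tendsto (fun y : ℝ => √(y ^ (1 - a) / (1 - a))) (𝓝[>] 0) (𝓝 0) := by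
  have h : Continuous fun y : ℝ => √(y ^ (1 - a) / (1 - a)) :=
    ((Real.continuous_rpow_const (by linarith)).div_const _).sqrt
  have := (h.tendsto 0).mono_left (nhdsWithin_le_nhds (s := Ioi 0))
  simpa [Real.zero_rpow (by linarith : 1 - a ≠ 0)] using this

theorem isTrace_trace (ha : a < 1) (v : EnergySpace Ω a) : IsTrace (toL2 v) (trace ha v) := by
  have h1 : Tendsto (fun y : ℝ => ENNReal.ofReal (√(y ^ (1 - a) / (1 - a)) * ‖v‖))
      (𝓝[>] (0 : ℝ) ⊓ ae volume) (𝓝 0) := by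
    have := ENNReal.tendsto_ofReal ((tendsto_sqrt_rpow ha).mul_const ‖v‖)
    rw [zero_mul, ENNReal.ofReal_zero] at this
    exact this.mono_left inf_le_left
  refine tendsto_of_tendsto_of_tendsto_of_le_of_le' tendsto_const_nhds h1
    (Eventually.of_forall fun _ => zero_le) ?_
  filter_upwards [eventually_nhdsWithin_inf_ae (trace_spec ha v)] with y hy
  exact hy.2

theorem isTrace_iff (ha : a < 1) (v : EnergySpace Ω a) (u : L2Gauss Ω) :
    IsTrace (toL2 v) u ↔ u = trace ha v :=
  ⟨fun h => h.unique (Lp.stronglyMeasurable _) (isTrace_trace ha v),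
    fun h => h ▸ isTrace_trace ha v⟩

theorem trace_add (ha : a < 1) (v w : EnergySpace Ω a) :
    trace ha (v + w) = trace ha v + trace ha w := by
  refine ((isTrace_iff ha _ _).1 (IsTrace.congr (a := a) ((isTrace_trace ha v).add
    (Lp.stronglyMeasurable _) (Lp.stronglyMeasurable _) (isTrace_trace ha w)) ?_)).symm
  rw [map_add]
  exact (Lp.coeFn_add _ _).symm

theorem trace_smul (ha : a < 1) (c : ℝ) (v : EnergySpace Ω a) :
    trace ha (c • v) = c • trace ha v := by
  refine ((isTrace_iff ha _ _).1 (IsTrace.congr (a := a) ((isTrace_trace ha v).smul c) ?_)).symm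
  rw [map_smul]
  exact (Lp.coeFn_smul _ _).symm

theorem powMeasure_Ioo_ne_zero (a : ℝ) {ε : ℝ} (hε : 0 < ε) : powMeasure a (Ioo ε (2 * ε)) ≠ 0 := by
  intro h0
  have h1 : ∀ᵐ y ∂powMeasure a, y ∉ Ioo ε (2 * ε) := by
    rwa [ae_iff, show {y | ¬y ∉ Ioo ε (2 * ε)} = Ioo ε (2 * ε) by ext; simp]
  rw [ae_powMeasure_iff, ae_restrict_iff' measurableSet_Ioi] at h1
  have h2 : volume (Ioo ε (2 * ε)) = 0 :=
    measure_mono_null (fun y hy => fun hn => hn (hε.trans hy.1) hy) (mem_ae_iff.1 h1)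
  rw [Real.volume_Ioo, ENNReal.ofReal_eq_zero] at h2
  linarith

theorem powMeasure_Ioo_lt_top (a : ℝ) {ε : ℝ} (hε : 0 < ε) :
    powMeasure a (Ioo ε (2 * ε)) < ⊤ := by
  rw [powMeasure, withDensity_apply _ measurableSet_Ioo,
    Measure.restrict_restrict measurableSet_Ioo,
    inter_eq_left.2 (show Ioo ε (2 * ε) ⊆ Ioi 0 from fun y hy => hε.trans hy.1)]
  have hc : ContinuousOn (fun y : ℝ => y ^ a) (Icc ε (2 * ε)) :=
    continuousOn_id.rpow_const fun y hy => Or.inl (hε.trans_le hy.1).ne'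
  exact (hc.integrableOn_Icc.mono_set Ioo_subset_Icc_self).lintegral_lt_top

/-- Some height in `(ε, 2ε)` has `‖∇ₓ v(·,y)‖²` at most its mean over the interval, and the mean is
at most `m ‖v‖²` with `m` the reciprocal of the weighted length. The height depends on `v`, but `A`
does not. -/
theorem exists_slice (ha : a < 1) {ε : ℝ} (hε : 0 < ε) : ∃ A : ℝ, 0 < A ∧
    ∀ v : EnergySpace Ω a, ∃ (u : L2Gauss Ω) (g : Lp (Eucl n) 2 (gaussOn Ω)),
      ‖u - trace ha v‖ ≤ √((2 * ε) ^ (1 - a) / (1 - a)) * ‖v‖ ∧ ‖g‖ ≤ A * ‖v‖ ∧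
      (1 - (gauss n).real (Ω : Set (Eucl n))) * ‖u‖ ^ 2 ≤ (Real.pi / 2) ^ 2 * ‖g‖ ^ 2 ∧
      ∀ θ, 0 ≤ θ → ∀ T, IsMehler Ω θ T → ‖u - T u‖ ≤ θ * ‖g‖ := by
  set m : ℝ≥0∞ := (powMeasure a (Ioo ε (2 * ε)))⁻¹ with hm
  have hm_top : m ≠ ⊤ := ENNReal.inv_ne_top.2 (powMeasure_Ioo_ne_zero a hε)
  -- The summand `1` only serves to make `A` positive.
  refine ⟨√m.toReal + 1, by positivity, fun v => ?_⟩
  have hGm : StronglyMeasurable (grad v) := Lp.stronglyMeasurable _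
  have hlat : ∀ᵐ y ∂(volume.restrict (Ioi (0 : ℝ))), MemH10 Ω fun x => toL2 v (x, y) :=
    ae_powMeasure_iff.1 v.2.2
  have hs := (hasWeakGradient v).ae_slice_memH10 ha (Lp.stronglyMeasurable _)
    (Lp.memLp (toL2 v)) hGm (Lp.memLp (grad v)) hlat
  have hgood := ae_powMeasure_iff (a := a) |>.2 (hs.and (trace_spec ha v))
  have : IsFiniteMeasure ((powMeasure a).restrict (Ioo ε (2 * ε))) :=
    ⟨by simpa using powMeasure_Ioo_lt_top a hε⟩
  -- The set to avoid: the heights where the slice properties or the trace bound fail, together with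
  -- everything outside the interval.
  have hN : (powMeasure a).restrict (Ioo ε (2 * ε)) (_ ∪ (Ioo ε (2 * ε))ᶜ) = 0 :=
    measure_union_null (measure_mono_null (le_refl _)
      (mem_ae_iff.1 (ae_restrict_of_ae (s := Ioo ε (2 * ε)) hgood)))
      (by rw [Measure.restrict_apply measurableSet_Ioo.compl]; simp)
  obtain ⟨y, hyN, hy⟩ := exists_notMem_null_le_laverage
    (f := fun y => eLpNorm (fun x => horiz (grad v) (x, y)) 2 (gaussOn Ω) ^ 2)
    (by rw [Ne, Measure.restrict_eq_zero]; exact powMeasure_Ioo_ne_zero a hε)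
    (measurable_eLpNorm_slice (stronglyMeasurable_horiz hGm)).aemeasurable hN
  rw [mem_union, not_or, notMem_compl_iff, notMem_compl_iff] at hyN
  obtain ⟨⟨⟨u, g, hu, hg, hP, hM⟩, htr⟩, hyI⟩ := hyN
  have hy0 : 0 < y := hε.trans hyI.1
  refine ⟨u, g, ?_, ?_, hP, hM⟩
  · have h1 : ‖u - trace ha v‖ₑ ≤ ENNReal.ofReal (√(y ^ (1 - a) / (1 - a)) * ‖v‖) := by
      rw [Lp.enorm_def]
      refine le_trans (le_of_eq (eLpNorm_congr_ae ?_)) htr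
      filter_upwards [Lp.coeFn_sub u (trace ha v), hu] with x h2 h3
      rw [h2, Pi.sub_apply, h3]
    rw [← ofReal_norm, ENNReal.ofReal_le_ofReal_iff (by positivity)] at h1
    refine h1.trans ?_
    have : 0 < 1 - a := by linarith
    have h4 : y ^ (1 - a) ≤ (2 * ε) ^ (1 - a) :=
      Real.rpow_le_rpow hy0.le hyI.2.le this.le
    gcongr
  · have h1 : ‖g‖ₑ ^ 2 ≤ m * ‖grad v‖ₑ ^ 2 := by
      rw [Lp.enorm_def, eLpNorm_congr_ae hg]
      refine hy.trans ?_
      rw [laverage_eq, Measure.restrict_apply_univ, ENNReal.div_eq_inv_mul, ← hm]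
      gcongr
      refine (setLIntegral_le_lintegral _ _).trans ?_
      rw [lintegral_slices (stronglyMeasurable_horiz hGm), Lp.enorm_def]
      gcongr
      exact eLpNorm_horiz_le _ _
    have h2 := ENNReal.toReal_mono (by finiteness) h1
    rw [ENNReal.toReal_mul, ENNReal.toReal_pow, ENNReal.toReal_pow, toReal_enorm, toReal_enorm,
      ← norm_eq] at h2
    refine le_of_sq_le_sq (h2.trans ?_) (by positivity)
    rw [mul_pow]
    gcongr
    have := Real.sq_sqrt (ENNReal.toReal_nonneg (a := m))
    nlinarith [Real.sqrt_nonneg m.toReal]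

/-- Here `γ(Ω) < 1` enters: it makes the constant `1 - γ(Ω)` on the left positive. -/
theorem norm_le_of_poincare (hΩ : gauss n (Ω : Set (Eucl n)) < 1) : ∃ K : ℝ, 0 < K ∧
    ∀ (u : L2Gauss Ω) (g : Lp (Eucl n) 2 (gaussOn Ω)),
      (1 - (gauss n).real (Ω : Set (Eucl n))) * ‖u‖ ^ 2 ≤ (Real.pi / 2) ^ 2 * ‖g‖ ^ 2 →
      ‖u‖ ≤ K * ‖g‖ := by
  have hc : 0 < 1 - (gauss n).real (Ω : Set (Eucl n)) := by
    rw [sub_pos, Measure.real, ← ENNReal.toReal_one]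
    exact ENNReal.toReal_strict_mono ENNReal.one_ne_top hΩ
  set c := 1 - (gauss n).real (Ω : Set (Eucl n))
  refine ⟨Real.pi / 2 / √c, by positivity, fun u g h => ?_⟩
  refine le_of_sq_le_sq ?_ (by positivity)
  rw [mul_pow, div_pow, Real.sq_sqrt hc.le, div_mul_eq_mul_div, le_div_iff₀ hc]
  linarith

/-- A slice at some height in `(1, 2)` is bounded by the Poincaré inequality, and the trace is at a
bounded distance from it. -/
theorem exists_norm_trace_le (ha : a < 1) (hΩ : gauss n (Ω : Set (Eucl n)) < 1) :
    ∃ C : ℝ, ∀ v : EnergySpace Ω a, ‖trace ha v‖ ≤ C * ‖v‖ := by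
  obtain ⟨A, hA, h⟩ := exists_slice (Ω := Ω) ha one_pos
  obtain ⟨K, hK, hP⟩ := norm_le_of_poincare hΩ
  refine ⟨K * A + √((2 * 1) ^ (1 - a) / (1 - a)), fun v => ?_⟩
  obtain ⟨u, g, h1, h2, h3, -⟩ := h v
  have h4 : ‖trace ha v‖ ≤ ‖u‖ + ‖u - trace ha v‖ := norm_le_norm_add_norm_sub _ _
  have h5 := hP u g h3
  have h6 := mul_le_mul_of_nonneg_left h2 hK.le
  linarith

/-- The trace operator. -/
def traceCLM (ha : a < 1) (hΩ : gauss n (Ω : Set (Eucl n)) < 1) :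
    EnergySpace Ω a →L[ℝ] L2Gauss Ω :=
  LinearMap.mkContinuous
    { toFun := trace ha
      map_add' := trace_add ha
      map_smul' := trace_smul ha }
    (exists_norm_trace_le ha hΩ).choose (exists_norm_trace_le ha hΩ).choose_spec

theorem isCompactOperator_traceCLM (ha : a < 1) (hΩ : gauss n (Ω : Set (Eucl n)) < 1) :
    IsCompactOperator (traceCLM (Ω := Ω) ha hΩ) := by
  suffices h : TotallyBounded (traceCLM (Ω := Ω) ha hΩ '' Metric.closedBall 0 1) from
    (isCompactOperator_iff_isCompact_closure_image_closedBall
      (traceCLM (Ω := Ω) ha hΩ : EnergySpace Ω a →ₗ[ℝ] L2Gauss Ω) one_pos).2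
      (h.closure.isCompact_of_isClosed isClosed_closure)
  obtain ⟨K, hK, hP⟩ := norm_le_of_poincare hΩ
  rw [Metric.totallyBounded_iff]
  intro δ hδ
  have hδ3 : 0 < δ / 3 := by positivity
  -- Below height `η`, every slice of an element of the unit ball satisfying the trace bound is
  -- within `δ/3` of the trace; the slice will be taken in `(η/2, η)`.
  obtain ⟨η, hη, hη0⟩ := (((tendsto_sqrt_rpow ha).eventually (gt_mem_nhds hδ3)).and
    self_mem_nhdsWithin).exists
  have hη0 : 0 < η := hη0
  obtain ⟨A, hA, h⟩ := exists_slice (Ω := Ω) ha (half_pos hη0)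
  rw [mul_div_cancel₀ η (two_ne_zero)] at h
  -- The first bound gives `θ A < δ/3`, halved for strictness; the second keeps `θ < π/2`, where the
  -- Mehler average is compact. The order matters: `A` blows up or not with `η`, so `θ` is chosen
  -- after `η`.
  set θ := min (δ / 3 / A / 2) (Real.pi / 4) with hθ
  have hθ0 : 0 < θ := lt_min (by positivity) (by positivity)
  have hθ1 : θ < Real.pi / 2 := (min_le_right _ _).trans_lt (by linarith [Real.pi_pos])
  have hθA : θ * A < δ / 3 := by
    have h1 : θ * A ≤ δ / 3 / A / 2 * A := by gcongr; exact min_le_left _ _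
    have h2 : δ / 3 / A / 2 * A = δ / 3 / 2 := by field_simp
    linarith
  obtain ⟨T, hTc, hT⟩ := exists_compact_mehler Ω hθ0 hθ1
  have hTb : TotallyBounded (T '' Metric.closedBall 0 (K * A)) :=
    (IsCompactOperator.isCompact_closure_image_closedBall
      (f := (T : L2Gauss Ω →ₗ[ℝ] L2Gauss Ω)) hTc (K * A)).totallyBounded.subset subset_closure
  -- The slices lie in a fixed ball of `L²(Ω, γ)`, so a finite `δ/3`-net for its image under `T`
  -- serves as a `δ`-net for the traces.
  obtain ⟨S, hS, hcov⟩ := Metric.totallyBounded_iff.1 hTb (δ / 3) hδ3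
  refine ⟨S, hS, ?_⟩
  rintro _ ⟨v, hv, rfl⟩
  rw [mem_closedBall_zero_iff] at hv
  obtain ⟨u, g, h1, h2, h3, h4⟩ := h v
  have hg : ‖g‖ ≤ A := h2.trans (mul_le_of_le_one_right hA.le hv)
  have hu : ‖u‖ ≤ K * A := (hP u g h3).trans (by gcongr)
  obtain ⟨w, hw, hTw⟩ := mem_iUnion₂.1 (hcov ⟨u, mem_closedBall_zero_iff.2 hu, rfl⟩)
  refine mem_iUnion₂.2 ⟨w, hw, ?_⟩
  rw [Metric.mem_ball] at hTw ⊢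
  have e1 : dist (trace ha v) u < δ / 3 := by
    rw [dist_comm, dist_eq_norm]
    exact lt_of_le_of_lt (h1.trans (mul_le_of_le_one_right (Real.sqrt_nonneg _) hv)) hη
  have e2 : dist u (T u) < δ / 3 := by
    rw [dist_eq_norm]
    refine lt_of_le_of_lt (h4 θ hθ0.le T hT) (lt_of_le_of_lt ?_ hθA)
    gcongr
  have e3 : dist (trace ha v) w ≤ dist (trace ha v) u + dist u (T u) + dist (T u) w :=
    dist_triangle4 _ _ _ _
  change dist (trace ha v) w < δ
  linarith

end EnergySpace

end trace

end GaussTrace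

end

theorem mainTheorem9 (n : ℕ) (Ω : TopologicalSpace.Opens (GaussTrace.Eucl n))
    (hΩ : GaussTrace.gauss n (Ω : Set (GaussTrace.Eucl n)) < 1)
    (s : ℝ) (hs0 : 0 < s) (hs1 : s < 1) :
    ∃ tr : GaussTrace.EnergySpace Ω (1 - 2 * s) →L[ℝ] GaussTrace.L2Gauss Ω,
      (∀ (v : GaussTrace.EnergySpace Ω (1 - 2 * s)) (u : GaussTrace.L2Gauss Ω),
        GaussTrace.IsTrace (GaussTrace.EnergySpace.toL2 v) u ↔ u = tr v) ∧
      IsCompactOperator tr := by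
  have ha : 1 - 2 * s < 1 := by linarith
  exact ⟨GaussTrace.EnergySpace.traceCLM ha hΩ, GaussTrace.EnergySpace.isTrace_iff ha,
    GaussTrace.EnergySpace.isCompactOperator_traceCLM ha hΩ⟩
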